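/- Let $k\ge 1$, let $L=(l_1,\dots,l_k)$ be positive integers and $n=l_1+\cdots+l_k$. Suppose that $L$ is generic ($\sum_{i\in I}l_i=\sum_{j\in J}l_j$ implies $I=J$, for all $I,J\subseteq\{1,\dots,k\}$) and reduced ($\gcd(l_1,\dots,l_k)=1$). The generalized tonnetz $Tonn^{n,k}(L)$ is the simplicial complex on the vertex set $\mathbb{Z}/n$ whose simplices are the nonempty subsets of the sets $$\Delta(x;\sigma)=\{x,\;x+l_{\sigma(1)},\;x+l_{\sigma(1)}+l_{\sigma(2)},\;\dots,\;x+l_{\sigma(1)}+\cdots+l_{\sigma(k-1)}\},$$ where $x\in\mathbb{Z}/n$ and $\sigma$ is a permutation of $\{1,\dots,k\}$. Then $Tonn^{n,k}(L)$ is a triangulation of the torus $(S^1)^{k-1}$, i.e. its geometric realization is homeomorphic to $(S^1)^{k-1}$. More precisely, let $H_0=\{x\in\mathbb{R}^k\mid x_1+\cdots+x_k=0\}$ and let $\Lambda\subset H_0$ be the permutohedral lattice $\mathbb{A}^*_{k-1}$ (scaled by $k$), consisting of all integer vectors with coordinate sum $0$ whose coordinates are all congruent modulo $k$. Let $\mathcal{D}_\Lambda$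 be its Delone triangulation, whose simplices are the nonempty finite sets of points of $\Lambda$ that lie on a sphere in $H_0$ (possibly of radius $0$) with no point of $\Lambda$ in its interior. Let $a_i\in\Lambda$ be the vector with $i$-th coordinate $k-1$ and all other coordinates $-1$. Let $\omega$ be the $\Lambda$-valued cochain on the oriented edges of $Tonn^{n,k}(L)$ with $\omega(\overrightarrow{uv})=\sum_{i\in I}a_i$, where $I\subseteq\{1,\dots,k\}$ is the unique subset with $v-u\equiv\sum_{i\in I}l_i \pmod n$, and let $\Lambda_L\subseteq\Lambda$ be the group of values of $\omega$ on the integral $1$-cycles of $Tonn^{n,k}(L)$. Then $\Lambda_L$ is a free abelian group of rank $k-1$, the quotient of $\mathcal{D}_\Lambda$ by the translations from $\Lambda_L$ is a simplicial complex on the vertex set $\Lambda/\Lambda_L$ (the projection $\Lambda\to\Lambda/\Lambda_L$ is injective on each simplex, and simplices with the same image are translates of each other by elements of $\Lambda_L$), and $Tonn^{n,k}(L)$ is isomorphic to $\mathcal{D}_\Lambda/\Lambda_L$. -/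

import Mathlib

namespace Tonnetz

/-! ### Generic and reduced length vectors, and the generalized tonnetz -/

/-- Distinct subsets of the index set have distinct sums. -/
def IsGeneric {k : ℕ} (l : Fin k → ℕ) : Prop :=
  ∀ I J : Finset (Fin k), ∑ i ∈ I, l i = ∑ j ∈ J, l j → I = J

/-- The greatest common divisor of all the lengths is `1`. -/
def HasGcdOne {k : ℕ} (l : Fin k → ℕ) : Prop :=
  Finset.univ.gcd l = 1

/-- The simplex
`Δ(x;σ) = {x, x + l_{σ(1)}, x + l_{σ(1)} + l_{σ(2)}, …, x + l_{σ(1)} + ⋯ + l_{σ(k-1)}}`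
in `ℤ/n`. -/
def maxSimplex (n : ℕ) {k : ℕ} (l : Fin k → ℕ) (x : ZMod n) (σ : Equiv.Perm (Fin k)) :
    Finset (ZMod n) :=
  Finset.univ.image fun j : Fin k => x + ((∑ i ∈ Finset.Iio j, l (σ i) : ℕ) : ZMod n)

/-- The generalized tonnetz: the simplicial complex on `ℤ/n` whose simplices are the nonempty
subsets of the sets `Δ(x;σ)`. -/
def tonn (n : ℕ) {k : ℕ} (l : Fin k → ℕ) : PreAbstractSimplicialComplex (ZMod n) where
  faces := {s | s.Nonempty ∧ ∃ (x : ZMod n) (σ : Equiv.Perm (Fin k)), s ⊆ maxSimplex n l x σ}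
  isRelLowerSet_faces := by
    rintro s ⟨hs, x, σ, h⟩
    exact ⟨hs, fun t hts ht => ⟨ht, x, σ, hts.trans h⟩⟩

/-! ### Simplicial complexes: realization, isomorphism, quotient by a translation group -/

/-- The geometric realization in barycentric coordinates: nonnegative weights of total mass `1`
carried by a face, with the topology of the space of all weights. For a complex on a finite vertex
type, the only case in which it is used, this is the usual topology. -/
def Realization {V : Type*} (K : PreAbstractSimplicialComplex V) : Type _ :=
  {w : V → ℝ // ∃ s ∈ K.faces, (∀ v, 0 ≤ w v) ∧ (∀ v, v ∉ s → w v = 0) ∧ ∑ v ∈ s, w v = 1}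

instance {V : Type*} (K : PreAbstractSimplicialComplex V) : TopologicalSpace (Realization K) :=
  inferInstanceAs (TopologicalSpace (Subtype _))

/-- `K` is a triangulation of the space `X`: its realization is homeomorphic to `X`. -/
def Triangulates {V : Type*} (K : PreAbstractSimplicialComplex V) (X : Type*)
    [TopologicalSpace X] : Prop :=
  Nonempty (Realization K ≃ₜ X)

/-- Isomorphism of simplicial complexes (all of whose vertices are faces): a bijection of the
vertices under which the faces correspond to each other. -/
def Isomorphic {V W : Type*} (K : PreAbstractSimplicialComplex V)
    (M : PreAbstractSimplicialComplex W) : Prop :=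
  ∃ φ : V ≃ W, ∀ s : Finset V, s ∈ K.faces ↔ s.map φ.toEmbedding ∈ M.faces

open Classical in
/-- The quotient of a simplicial complex, whose vertices form an abelian group, by the translations
from the subgroup `N`: the vertices are the cosets of `N`, the faces are the images of faces. -/
noncomputable def quotientComplex {A : Type*} [AddCommGroup A]
    (K : PreAbstractSimplicialComplex A) (N : AddSubgroup A) :
    PreAbstractSimplicialComplex (A ⧸ N) :=
  K.map (QuotientAddGroup.mk : A → A ⧸ N)

open Classical in
/-- The quotient by `N` involves no degeneration: the projection is injective on each face, and two
faces have the same image only if a translation from `N` carries one to the other. Thus the faces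
of the quotient complex are the `N`-orbits of faces, of the same dimension. -/
def IsRegularQuotient {A : Type*} [AddCommGroup A]
    (K : PreAbstractSimplicialComplex A) (N : AddSubgroup A) : Prop :=
  (∀ s ∈ K.faces, Set.InjOn (QuotientAddGroup.mk : A → A ⧸ N) s) ∧
  ∀ s ∈ K.faces, ∀ t ∈ K.faces,
    s.image (QuotientAddGroup.mk : A → A ⧸ N) = t.image (QuotientAddGroup.mk : A → A ⧸ N) →
      ∃ g ∈ N, t = s.image (fun z => g + z)

/-! ### The permutohedral lattice and its Delone triangulation -/

/-- The hyperplane `H₀ = {x | x₁ + ⋯ + x_k = 0}` of the Euclidean space `ℝ^k`. -/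
def sumZero (k : ℕ) : Submodule ℝ (EuclideanSpace ℝ (Fin k)) where
  carrier := {x | ∑ i, x i = 0}
  add_mem' := by
    intro x y hx hy
    simp only [Set.mem_ofPred_eq] at *
    simp [Finset.sum_add_distrib, hx, hy]
  zero_mem' := by simp
  smul_mem' := by
    intro c x hx
    simp only [Set.mem_ofPred_eq] at *
    simp [← Finset.mul_sum, hx]

/-- The permutohedral lattice `A*_{k-1}` (scaled by `k`): the integer vectors with coordinate
sum `0` whose coordinates all lie in the same congruence class modulo `k`. -/
def permLattice (k : ℕ) : AddSubgroup (EuclideanSpace ℝ (Fin k)) where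
  carrier := {x | x ∈ sumZero k ∧
    ∃ m : Fin k → ℤ, (∀ i, x i = m i) ∧ ∀ i j, m i ≡ m j [ZMOD k]}
  add_mem' := by
    rintro x y ⟨hx, m, hm, hmm⟩ ⟨hy, p, hp, hpp⟩
    exact ⟨add_mem hx hy, m + p, fun i => by simp [hm, hp], fun i j => (hmm i j).add (hpp i j)⟩
  zero_mem' := ⟨zero_mem _, 0, by simp, fun i j => Int.ModEq.refl _⟩
  neg_mem' := by
    rintro x ⟨hx, m, hm, hmm⟩
    exact ⟨neg_mem hx, -m, fun i => by simp [hm], fun i j => (hmm i j).neg⟩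

/-- The Delone complex of the permutohedral lattice in `H₀`: a nonempty finite set of lattice points
is a simplex if it lies on an empty sphere, that is, if there are a centre `c ∈ H₀` and a radius `r`
such that no lattice point is at distance less than `r` from `c`, while the points of the set are
at distance exactly `r`. -/
def deloneComplex (k : ℕ) : PreAbstractSimplicialComplex (permLattice k) where
  faces := {s | s.Nonempty ∧ ∃ c ∈ sumZero k, ∃ r : ℝ,
    (∀ z : permLattice k, r ≤ dist (z : EuclideanSpace ℝ (Fin k)) c) ∧
      ∀ z ∈ s, dist (z : EuclideanSpace ℝ (Fin k)) c = r}
  isRelLowerSet_faces := by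
    rintro s ⟨hs, c, hc, r, h₁, h₂⟩
    exact ⟨hs, fun t hts ht => ⟨ht, c, hc, r, h₁, fun z hz => h₂ z (hts hz)⟩⟩

/-- The lattice vector `a_i = k e_i - (1, …, 1)`, with `i`-th coordinate `k - 1` and all other
coordinates `-1`. -/
noncomputable def latticeVec (k : ℕ) (i : Fin k) : permLattice k :=
  ⟨WithLp.toLp 2 fun j => if j = i then (k : ℝ) - 1 else -1, by
    refine ⟨?_, fun j => if j = i then (k : ℤ) - 1 else -1, fun j => ?_, fun j j' => ?_⟩
    · have h : ∀ j : Fin k, (if j = i then (k : ℝ) - 1 else -1)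
          = (if j = i then (k : ℝ) else 0) - 1 := by
        intro j; split_ifs <;> ring
      change ∑ j : Fin k, (if j = i then (k : ℝ) - 1 else -1) = 0
      simp [h]
    · dsimp only
      split_ifs <;> simp
    · have h : ∀ j : Fin k, (if j = i then (k : ℤ) - 1 else -1) ≡ -1 [ZMOD k] := by
        intro j
        split_ifs
        · exact (Int.modEq_iff_dvd.2 ⟨-1, by ring⟩)
        · rfl
      exact (h j).trans (h j').symm⟩

/-! ### The canonical cocycle and its lattice of periods -/

/-- The oriented `1`-simplices of the generalized tonnetz. -/
abbrev OrientedEdge (n : ℕ) {k : ℕ} (l : Fin k → ℕ) : Type :=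
  {e : ZMod n × ZMod n // e.1 ≠ e.2 ∧ ({e.1, e.2} : Finset (ZMod n)) ∈ (tonn n l).faces}

/-- The canonical vector valued `1`-cocycle `ω = (ω₁, …, ω_k)`. If `I ⊆ [k]` is the type of the
oriented edge from `u` to `v`, that is, `v - u = ∑_{i ∈ I} l_i` in `ℤ/n`, then
`ω(uv) = ∑_{i ∈ I} a_i`. For generic lengths there is exactly one such `I`, so that the outer sum
has a single term. In particular, `ω` has the value `a_i` on each edge from `x` to `x + l_i`. -/
noncomputable def omega (n : ℕ) {k : ℕ} (l : Fin k → ℕ) (e : OrientedEdge n l) : permLattice k :=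
  ∑ I : Finset (Fin k) with ((∑ i ∈ I, l i : ℕ) : ZMod n) = e.1.2 - e.1.1,
    ∑ i ∈ I, latticeVec k i

/-- The group of integral `1`-cycles: the integral combinations of oriented edges with boundary
zero, where the boundary of the edge from `u` to `v` is `v - u`. -/
noncomputable def cycles (n : ℕ) {k : ℕ} (l : Fin k → ℕ) : Submodule ℤ (OrientedEdge n l →₀ ℤ) :=
  LinearMap.ker (Finsupp.linearCombination ℤ fun e : OrientedEdge n l =>
    (Finsupp.single e.1.2 1 - Finsupp.single e.1.1 1 : ZMod n →₀ ℤ))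

/-- The lattice `Λ_L` of periods of the canonical cocycle: its values on integral `1`-cycles, that
is, the image of the first homology group of the tonnetz under `ω`. -/
noncomputable def periodLattice (n : ℕ) {k : ℕ} (l : Fin k → ℕ) : AddSubgroup (permLattice k) :=
  ((cycles n l).map (Finsupp.linearCombination ℤ (omega n l))).toAddSubgroup

end Tonnetz

/-!
The lattice `Λ` is `ℤ^k` modulo the constant vectors, with `a_i` the class of the `i`-th unit
vector, and `a_i ↦ l_i` defines a homomorphism `Λ → ℤ/n`, the degree. Everything follows from the
study of this map.

The Delone simplices are the nonempty subsets of the chains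
`z, z + a_{σ(1)}, z + a_{σ(1)} + a_{σ(2)}, …` (`mem_deloneComplex_of_subset_latticeSimplex`,
`exists_subset_latticeSimplex`). Indeed the squared distance of `∑ m_i a_i` from `c ∈ H₀` is, up to scaling and a constant,
`∑_{i<j} (m_i - m_j)² - 2 ∑ c_i m_i`. For the centre of a chain this becomes a sum of terms `d² - d` with integers
`d`, which are nonnegative; for general `c`, an exchange argument shows that two minimizers differ
by the indicator of a subset, and that the subsets arising from one sphere are nested. Hence the
faces of the tonnetz are exactly the images of Delone simplices under the degree (`mem_tonn_iff`).
Genericity says that a proper subset is determined by its sum modulo `n`, so that the difference of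
two vertices of a simplex is determined by their degrees (`sub_eq_sub_of_mem_faces`); this gives
the regularity of the quotient by the kernel of the degree. Since the tonnetz contains all edges
from `x` to `x + l_i`, the period lattice is this kernel (`periodLattice_eq_ker`). It has finite
index in `Λ`, hence rank `k - 1`.

For the homeomorphism with the torus, the barycentric coordinates of a point of
`H₀ = ℝ^k / ℝ(1, …, 1)` in the Delone triangulation, pushed to `ℤ/n`, have a closed form:
the coordinate of `t ∈ ℝ^k` at `x` is the measure of the set of `s ∈ [0, 1]` for which `⌊t + s(1, …, 1)⌋` has degree `x`
(`weight`). As `s` runs through `[0, 1]`, the floor vector runs through a chain, and its mean is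
`t`. The resulting map from `H₀` to the realization is continuous, it is onto (`exists_weight_eq`),
and its fibres are the cosets of the period lattice (`weight_eq_weight_iff`). A lattice basis
identifies `H₀` modulo this lattice with `(S¹)^{k-1}`.
-/

namespace Tonnetz

open Finset

variable {k n : ℕ}

/-! ### The permutohedral lattice as a quotient of `ℤ^k` -/

/-- The indicator vector of `I` in `ℤ^k`. -/
def ind (I : Finset (Fin k)) (i : Fin k) : ℤ := if i ∈ I then 1 else 0

theorem latticeVec_apply (i j : Fin k) :
    (latticeVec k i : EuclideanSpace ℝ (Fin k)) j = (if j = i then (k : ℝ) else 0) - 1 := by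
  change (if j = i then (k : ℝ) - 1 else -1) = _
  split_ifs <;> ring

/-- The homomorphism `m ↦ ∑ m_i a_i` from `ℤ^k` to the permutohedral lattice. It is onto, with
kernel the constant vectors, so that `Λ = ℤ^k / ℤ(1, …, 1)`. -/
noncomputable def latticePt (k : ℕ) : (Fin k → ℤ) →+ permLattice k where
  toFun m := ∑ i, m i • latticeVec k i
  map_zero' := by simp
  map_add' m m' := by simp [add_smul, sum_add_distrib]

theorem latticePt_def (m : Fin k → ℤ) : latticePt k m = ∑ i, m i • latticeVec k i := rfl

theorem latticePt_apply (m : Fin k → ℤ) (j : Fin k) :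
    (latticePt k m : EuclideanSpace ℝ (Fin k)) j = k * m j - ∑ i, (m i : ℝ) := by
  rw [latticePt_def]
  simp [latticeVec_apply, mul_sub, sum_sub_distrib, mul_comm]

theorem latticePt_ind (I : Finset (Fin k)) : latticePt k (ind I) = ∑ i ∈ I, latticeVec k i := by
  simp [latticePt_def, ind, ite_smul, sum_ite_mem]

theorem latticePt_const (c : ℤ) : latticePt k (fun _ => c) = 0 := by
  ext j
  simp [latticePt_apply]

theorem latticePt_ind_univ : latticePt k (ind univ) = 0 := by
  convert latticePt_const (k := k) 1
  simp [ind]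

theorem eq_add_const_of_latticePt_eq (hk : 0 < k) {m m' : Fin k → ℤ}
    (h : latticePt k m = latticePt k m') : ∃ c : ℤ, ∀ i, m i = m' i + c := by
  refine ⟨m ⟨0, hk⟩ - m' ⟨0, hk⟩, fun i => ?_⟩
  have e (j : Fin k) : (k : ℝ) * m j - ∑ i, (m i : ℝ) = k * m' j - ∑ i, (m' i : ℝ) := by
    rw [← latticePt_apply, ← latticePt_apply, h]
  have hk' : (k : ℝ) ≠ 0 := by positivity
  have : (k : ℝ) * m i = k * (m' i + (m ⟨0, hk⟩ - m' ⟨0, hk⟩)) := by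
    linear_combination e i - e ⟨0, hk⟩
  exact_mod_cast mul_left_cancel₀ hk' this

theorem latticePt_surjective (hk : 0 < k) : Function.Surjective (latticePt k) := by
  rintro ⟨x, hx, p, hp, hpp⟩
  choose q hq using fun i => (hpp ⟨0, hk⟩ i).dvd
  refine ⟨q, ?_⟩
  ext j
  have hsum : ∑ i, x i = 0 := hx
  have hx' (i : Fin k) : x i = p ⟨0, hk⟩ + k * q i := by
    have := congrArg (Int.cast : ℤ → ℝ) (hq i)
    push_cast at this
    rw [hp]
    linarith
  simp only [hx', sum_add_distrib, ← mul_sum, sum_const, card_univ, Fintype.card_fin,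
    nsmul_eq_mul, ← mul_add] at hsum
  have hk' : (k : ℝ) ≠ 0 := by positivity
  have := (mul_eq_zero.1 hsum).resolve_left hk'
  rw [latticePt_apply, hx']
  linarith

/-! ### The degree map -/

/-- The degree of `m ∈ ℤ^k`: the residue of `∑ m_i l_i` modulo `n`. -/
noncomputable def intDegree (n : ℕ) (l : Fin k → ℕ) : (Fin k → ℤ) →+ ZMod n where
  toFun m := ((∑ i, m i * l i : ℤ) : ZMod n)
  map_zero' := by simp
  map_add' m m' := by simp [add_mul, sum_add_distrib]

theorem intDegree_apply (l : Fin k → ℕ) (m : Fin k → ℤ) :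
    intDegree n l m = ((∑ i, m i * l i : ℤ) : ZMod n) := rfl

theorem intDegree_ind (l : Fin k → ℕ) (I : Finset (Fin k)) :
    intDegree n l (ind I) = ((∑ i ∈ I, l i : ℕ) : ZMod n) := by
  rw [intDegree_apply]
  simp [ind, sum_ite_mem]

theorem intDegree_const {l : Fin k → ℕ} (hsum : ∑ i, l i = n) (c : ℤ) :
    intDegree n l (fun _ => c) = 0 := by
  have : (∑ i, (l i : ZMod n)) = 0 := by rw [← Nat.cast_sum, hsum]; simp
  simp [intDegree_apply, ← mul_sum, this]

theorem intDegree_surjective {l : Fin k → ℕ} (hred : HasGcdOne l) :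
    Function.Surjective (intDegree n l) := by
  intro x
  obtain ⟨g, hg⟩ := Finset.gcd_eq_sum_mul (univ : Finset (Fin k)) (fun i => (l i : ℤ))
  have h1 : IsUnit (univ.gcd fun i => (l i : ℤ)) := by
    rw [Int.isUnit_iff_natAbs_eq, ← Nat.dvd_one, ← hred]
    exact Finset.dvd_gcd fun i hi => Int.natAbs_dvd_natAbs.2 (Finset.gcd_dvd hi)
  obtain ⟨z, rfl⟩ := ZMod.intCast_surjective x
  obtain ⟨u, hu⟩ := h1.dvd (a := z)
  refine ⟨fun i => u * g i, ?_⟩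
  rw [intDegree_apply, hu, hg, sum_mul]
  congr 1
  exact sum_congr rfl fun i _ => by ring

/-- The degree vanishes on constant vectors, hence descends to the lattice; this is the projection
`Λ → ℤ/n` sending `a_i` to `l_i`. -/
theorem exists_degree (hk : 0 < k) {l : Fin k → ℕ} (hsum : ∑ i, l i = n) :
    ∃ f : permLattice k →+ ZMod n, ∀ m, f (latticePt k m) = intDegree n l m := by
  have hker : (latticePt k).ker ≤ (intDegree n l).ker := by
    intro m hm
    obtain ⟨c, hc⟩ := eq_add_const_of_latticePt_eq hk
      (show latticePt k m = latticePt k 0 by rw [AddMonoidHom.mem_ker.1 hm, map_zero])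
    obtain rfl : m = fun _ => c := funext fun i => by simpa using hc i
    exact intDegree_const hsum c
  refine ⟨(latticePt k).liftOfRightInverse _ (Function.rightInverse_surjInv
    (latticePt_surjective hk)) ⟨intDegree n l, hker⟩, fun m => ?_⟩
  exact AddMonoidHom.liftOfRightInverse_comp_apply _ _ _ ⟨intDegree n l, hker⟩ m

/-! ### Subset sums modulo `n` and chains -/

/-- Genericity modulo `n`: sums over proper subsets lie in `[0, n)`, so a congruence between two of
them is an equality. -/
theorem eq_of_cast_sum_eq {l : Fin k → ℕ} (hpos : ∀ i, 0 < l i) (hsum : ∑ i, l i = n)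
    (hgen : IsGeneric l) {I J : Finset (Fin k)} (hI : I ≠ univ) (hJ : J ≠ univ)
    (h : ((∑ i ∈ I, l i : ℕ) : ZMod n) = ((∑ i ∈ J, l i : ℕ) : ZMod n)) : I = J := by
  have hlt {I : Finset (Fin k)} (hI : I ≠ univ) : ∑ i ∈ I, l i < n := by
    obtain ⟨i, -, hi⟩ := exists_of_ssubset (ssubset_univ_iff.2 hI)
    rw [← hsum]
    exact sum_lt_sum_of_subset (subset_univ I) (mem_univ i) hi (hpos i) (by simp)
  rw [ZMod.natCast_eq_natCast_iff', Nat.mod_eq_of_lt (hlt hI), Nat.mod_eq_of_lt (hlt hJ)] at h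
  exact hgen I J h

/-- If `σ` sorts the indices by increasing `f`, a proper subset that is downward closed for `f` is
an initial segment `σ {0, …, j - 1}`. -/
theorem exists_eq_map_Iio {α : Type*} [LinearOrder α] (f : Fin k → α) (σ : Equiv.Perm (Fin k))
    (hσ : Monotone (f ∘ σ)) {I : Finset (Fin k)} (hI : I ≠ univ)
    (hlow : ∀ i ∈ I, ∀ j, f j ≤ f i → j ∈ I) : ∃ j : Fin k, I = (Iio j).map σ.toEmbedding := by
  have hne : {a : Fin k | σ a ∉ I}.Nonempty := by
    obtain ⟨i, -, hi⟩ := exists_of_ssubset (ssubset_univ_iff.2 hI)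
    exact ⟨σ.symm i, by simpa using hi⟩
  obtain ⟨j, hj, hmin⟩ := WellFounded.has_min (wellFounded_lt (α := Fin k)) _ hne
  refine ⟨j, ?_⟩
  ext i
  obtain ⟨a, rfl⟩ := σ.surjective i
  simp only [mem_map_equiv, Equiv.symm_apply_apply, mem_Iio]
  refine ⟨fun ha => ?_, fun ha => by_contra fun h => hmin a h ha⟩
  by_contra hja
  exact hj (hlow _ ha _ (hσ (not_lt.1 hja)))

theorem map_Iio_ne_univ (σ : Equiv.Perm (Fin k)) (j : Fin k) :
    (Iio j).map σ.toEmbedding ≠ univ := by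
  intro h
  have : σ j ∈ (Iio j).map σ.toEmbedding := by rw [h]; exact mem_univ _
  simp at this

theorem mem_maxSimplex (l : Fin k → ℕ) (x y : ZMod n) (σ : Equiv.Perm (Fin k)) :
    y ∈ maxSimplex n l x σ ↔
      ∃ j : Fin k, x + ((∑ i ∈ (Iio j).map σ.toEmbedding, l i : ℕ) : ZMod n) = y := by
  simp [maxSimplex]

/-- The lattice counterpart of `Δ(x;σ)`: all points `z + a_{σ(1)} + ⋯ + a_{σ(j)}` for `j < k`. -/
noncomputable def latticeSimplex (z : permLattice k) (σ : Equiv.Perm (Fin k)) :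
    Set (permLattice k) :=
  Set.range fun j : Fin k => z + latticePt k (ind ((Iio j).map σ.toEmbedding))

/-! ### Chains lie on empty spheres -/

theorem sum_sum_sub_sq (x : Fin k → ℝ) :
    ∑ i, ∑ j, (x i - x j) ^ 2 = 2 * (k * ∑ i, x i ^ 2 - (∑ i, x i) ^ 2) := by
  have h (i : Fin k) : ∑ j, (x i - x j) ^ 2
      = k * x i ^ 2 - 2 * (∑ j, x j) * x i + ∑ j, x j ^ 2 := by
    simp only [sub_sq, sum_add_distrib, sum_sub_distrib, sum_const, card_univ, Fintype.card_fin,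
      nsmul_eq_mul, ← mul_sum]
    ring
  simp only [h, sum_add_distrib, sum_sub_distrib, ← mul_sum, sum_const, card_univ,
    Fintype.card_fin, nsmul_eq_mul]
  ring

/-- Up to scaling and a constant, the squared distance from a lattice point to `c` is
`∑_{i<j} (m_i - m_j)² - 2 ∑ c_i m_i`. The sum over pairs is written as half a double sum. -/
theorem dist_latticePt_sq (m : Fin k → ℤ) {c : EuclideanSpace ℝ (Fin k)} (hc : c ∈ sumZero k) :
    dist (latticePt k m : EuclideanSpace ℝ (Fin k)) c ^ 2
      = k * (1 / 2 * ∑ i, ∑ j, ((m i : ℝ) - m j) ^ 2 - 2 * ∑ i, c i * m i) + ∑ i, c i ^ 2 := by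
  have hc' : ∑ i, c i = 0 := hc
  rw [EuclideanSpace.dist_eq, Real.sq_sqrt (sum_nonneg fun i _ => sq_nonneg _)]
  rw [sum_sum_sub_sq]
  set S := ∑ i, (m i : ℝ) with hS
  have h (i : Fin k) : dist ((latticePt k m : EuclideanSpace ℝ (Fin k)) i) (c i) ^ 2
      = k ^ 2 * (m i : ℝ) ^ 2 - 2 * k * S * m i + S ^ 2 - 2 * k * (c i * m i) + 2 * S * c i
        + c i ^ 2 := by
    rw [Real.dist_eq, sq_abs, latticePt_apply]
    ring
  simp only [h, sum_add_distrib, sum_sub_distrib, ← mul_sum, sum_const, card_univ,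
    Fintype.card_fin, nsmul_eq_mul, hc', ← hS]
  ring

/-- The sign of `σ⁻¹ j - σ⁻¹ i`. -/
noncomputable def orderSign (σ : Equiv.Perm (Fin k)) (i j : Fin k) : ℝ :=
  if σ.symm i < σ.symm j then 1 else if σ.symm j < σ.symm i then -1 else 0

theorem orderSign_antisymm (σ : Equiv.Perm (Fin k)) (i j : Fin k) :
    orderSign σ j i = -orderSign σ i j := by
  unfold orderSign
  split_ifs with h h' <;> first | exact (lt_asymm h h').elim | simp

/-- The centre of the empty sphere through the chain of `σ` starting at `0`. Its `σ(j)`-th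
coordinate is `(k - 1 - 2j) / 2` for `0 ≤ j < k`; the sum of signs avoids this explicit form. -/
noncomputable def chainCenter (σ : Equiv.Perm (Fin k)) : EuclideanSpace ℝ (Fin k) :=
  WithLp.toLp 2 fun i => 1 / 2 * ∑ j, orderSign σ i j

theorem chainCenter_apply (σ : Equiv.Perm (Fin k)) (i : Fin k) :
    chainCenter σ i = 1 / 2 * ∑ j, orderSign σ i j := rfl

theorem two_mul_sum_chainCenter_mul (σ : Equiv.Perm (Fin k)) (x : Fin k → ℝ) :
    2 * ∑ i, chainCenter σ i * x i = 1 / 2 * ∑ i, ∑ j, orderSign σ i j * (x i - x j) := by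
  have h1 : ∑ i, ∑ j, orderSign σ i j * x j = -∑ i, ∑ j, orderSign σ i j * x i := by
    rw [sum_comm, ← sum_neg_distrib]
    refine sum_congr rfl fun i _ => ?_
    rw [← sum_neg_distrib]
    exact sum_congr rfl fun j _ => by rw [orderSign_antisymm, neg_mul]
  simp only [mul_sub, sum_sub_distrib, h1, chainCenter_apply, mul_assoc, ← mul_sum, sum_mul]
  ring

theorem chainCenter_mem (σ : Equiv.Perm (Fin k)) : chainCenter σ ∈ sumZero k := by
  have := two_mul_sum_chainCenter_mul σ (fun _ => 1)
  simp only [mul_one, sub_self, mul_zero, sum_const_zero] at this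
  change ∑ i, chainCenter σ i = 0
  linarith

/-- With `d = m_i - m_j`, each pair contributes `d² - ±d`, which is nonnegative for an integer `d`,
and zero for the points of the chain. -/
theorem dist_latticePt_chainCenter_sq (σ : Equiv.Perm (Fin k)) (m : Fin k → ℤ) :
    dist (latticePt k m : EuclideanSpace ℝ (Fin k)) (chainCenter σ) ^ 2
      = k * (1 / 2 * ∑ i, ∑ j, (((m i : ℝ) - m j) ^ 2 - orderSign σ i j * (m i - m j)))
        + ∑ i, chainCenter σ i ^ 2 := by
  rw [dist_latticePt_sq m (chainCenter_mem σ), two_mul_sum_chainCenter_mul]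
  simp only [sum_sub_distrib]
  ring

/-- No lattice point lies inside the sphere around `chainCenter σ` through the origin. -/
theorem dist_chainCenter_le (σ : Equiv.Perm (Fin k)) (m : Fin k → ℤ) :
    ∑ i, chainCenter σ i ^ 2
      ≤ dist (latticePt k m : EuclideanSpace ℝ (Fin k)) (chainCenter σ) ^ 2 := by
  rw [dist_latticePt_chainCenter_sq]
  have : 0 ≤ ∑ i, ∑ j, (((m i : ℝ) - m j) ^ 2 - orderSign σ i j * (m i - m j)) := by
    refine sum_nonneg fun i _ => sum_nonneg fun j _ => ?_
    have hd : |m i - m j| ≤ (m i - m j) ^ 2 := by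
      rw [← sq_abs]
      exact Int.le_self_sq _
    have hd' : |(m i : ℝ) - m j| ≤ ((m i : ℝ) - m j) ^ 2 := by exact_mod_cast hd
    have := le_abs_self ((m i : ℝ) - m j)
    have := neg_abs_le ((m i : ℝ) - m j)
    have := abs_nonneg ((m i : ℝ) - m j)
    unfold orderSign
    split_ifs <;> linarith
  have : (0 : ℝ) ≤ k * (1 / 2 *
    ∑ i, ∑ j, (((m i : ℝ) - m j) ^ 2 - orderSign σ i j * (m i - m j))) := by positivity
  linarith

theorem dist_chainCenter_of_chain (σ : Equiv.Perm (Fin k)) (a : Fin k) :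
    dist (latticePt k (ind ((Iio a).map σ.toEmbedding)) : EuclideanSpace ℝ (Fin k))
      (chainCenter σ) ^ 2 = ∑ i, chainCenter σ i ^ 2 := by
  rw [dist_latticePt_chainCenter_sq]
  rw [sum_eq_zero fun i _ => sum_eq_zero fun j _ => ?_]
  · simp
  · simp only [ind, mem_map_equiv, mem_Iio, orderSign]
    split_ifs <;> first | (exfalso; order) | norm_num

theorem mem_deloneComplex_of_subset_latticeSimplex (hk : 0 < k) {s : Finset (permLattice k)}
    (hs : s.Nonempty) {z : permLattice k} {σ : Equiv.Perm (Fin k)}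
    (h : (s : Set (permLattice k)) ⊆ latticeSimplex z σ) : s ∈ (deloneComplex k).faces := by
  refine ⟨hs, z + chainCenter σ, add_mem z.2.1 (chainCenter_mem σ),
    √(∑ i, chainCenter σ i ^ 2), fun w => ?_, fun w hw => ?_⟩
  · obtain ⟨m, hm⟩ := latticePt_surjective hk (w - z)
    obtain rfl : w = z + latticePt k m := by rw [hm]; abel
    rw [AddSubgroup.coe_add, dist_add_left]
    exact Real.sqrt_le_iff.2 ⟨dist_nonneg, dist_chainCenter_le σ m⟩
  · obtain ⟨a, rfl⟩ := h hw
    rw [AddSubgroup.coe_add, dist_add_left, ← dist_chainCenter_of_chain σ a,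
      Real.sqrt_sq dist_nonneg]

/-! ### Delone simplices are chains -/

/-- If `m` and `m'` both give lattice points closest to `c`, the entries of `m' - m` differ by at
most `1`. Otherwise let `I` be the set where `m' - m` is maximal: replacing `m` by `m + 1_I` and
`m'` by `m' - 1_I` keeps the linear part of the sum of the two squared distances and lowers the
quadratic part. -/
theorem sub_le_one_of_minimal {c : EuclideanSpace ℝ (Fin k)} (hc : c ∈ sumZero k)
    {r : ℝ} (hr : ∀ z : permLattice k, r ≤ dist (z : EuclideanSpace ℝ (Fin k)) c)
    {m m' : Fin k → ℤ} (hm : dist (latticePt k m : EuclideanSpace ℝ (Fin k)) c = r)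
    (hm' : dist (latticePt k m' : EuclideanSpace ℝ (Fin k)) c = r) (i j : Fin k) :
    (m' i - m i) - (m' j - m j) ≤ 1 := by
  by_contra! hij
  have : Nonempty (Fin k) := ⟨i⟩
  obtain ⟨i₀, hi₀⟩ := Finite.exists_max fun i => m' i - m i
  set I : Finset (Fin k) := {i | m' i - m i = m' i₀ - m i₀} with hI
  have hr0 : 0 ≤ r := hm ▸ dist_nonneg
  have h1 := pow_le_pow_left₀ hr0 (hr (latticePt k (m + ind I))) 2
  have h2 := pow_le_pow_left₀ hr0 (hr (latticePt k (m' - ind I))) 2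
  have e1 := congrArg (· ^ 2) hm
  have e2 := congrArg (· ^ 2) hm'
  simp only [dist_latticePt_sq _ hc] at h1 h2 e1 e2
  have hk : (0 : ℝ) < k := by exact_mod_cast i.pos
  have hlin : ∑ i, c i * ((m + ind I) i : ℤ) + ∑ i, c i * ((m' - ind I) i : ℤ)
      = ∑ i, c i * (m i : ℝ) + ∑ i, c i * (m' i : ℝ) := by
    rw [← sum_add_distrib, ← sum_add_distrib]
    refine sum_congr rfl fun i _ => ?_
    simp only [Pi.add_apply, Pi.sub_apply]
    push_cast
    ring
  have hle (a b : Fin k) : ((m + ind I) a - (m + ind I) b) ^ 2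
      + ((m' - ind I) a - (m' - ind I) b) ^ 2 ≤ (m a - m b) ^ 2 + (m' a - m' b) ^ 2 := by
    have ha := hi₀ a
    have hb := hi₀ b
    simp only [Pi.add_apply, Pi.sub_apply, ind, hI, mem_filter, mem_univ, true_and]
    split_ifs with h h'
    · linarith
    · have : m' b - m b < m' a - m a := by omega
      nlinarith
    · have : m' a - m a < m' b - m b := by omega
      nlinarith
    · linarith
  have hlt : ((m + ind I) i₀ - (m + ind I) j) ^ 2
      + ((m' - ind I) i₀ - (m' - ind I) j) ^ 2 < (m i₀ - m j) ^ 2 + (m' i₀ - m' j) ^ 2 := by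
    have ha := hi₀ i
    have hj : ¬ (m' j - m j = m' i₀ - m i₀) := by omega
    simp only [Pi.add_apply, Pi.sub_apply, ind, hI, mem_filter, mem_univ, true_and, if_true, hj,
      if_false]
    nlinarith
  have hquad : ∑ a, ∑ b, (((m + ind I) a - (m + ind I) b) ^ 2
      + ((m' - ind I) a - (m' - ind I) b) ^ 2) < ∑ a, ∑ b, ((m a - m b) ^ 2 + (m' a - m' b) ^ 2) :=
    sum_lt_sum (fun a _ => sum_le_sum fun b _ => hle a b)
      ⟨i₀, mem_univ _, sum_lt_sum (fun b _ => hle i₀ b) ⟨j, mem_univ _, hlt⟩⟩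
  have hquad' : ∑ a, ∑ b, ((((m + ind I) a : ℤ) : ℝ) - ((m + ind I) b : ℤ)) ^ 2
      + ∑ a, ∑ b, ((((m' - ind I) a : ℤ) : ℝ) - ((m' - ind I) b : ℤ)) ^ 2
      < ∑ a, ∑ b, ((m a : ℝ) - m b) ^ 2 + ∑ a, ∑ b, ((m' a : ℝ) - m' b) ^ 2 := by
    simp only [sum_add_distrib] at hquad
    exact_mod_cast hquad
  nlinarith [mul_lt_mul_of_pos_left hquad' hk]

/-- Two vertices of a Delone simplex differ by `∑_{i ∈ I} a_i` with `I` a proper subset. -/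
theorem exists_eq_latticePt_add_of_mem {s : Finset (permLattice k)}
    (hs : s ∈ (deloneComplex k).faces) {m : Fin k → ℤ} {v : permLattice k}
    (hm : latticePt k m ∈ s) (hv : v ∈ s) (hk : 0 < k) :
    ∃ I : Finset (Fin k), I ≠ univ ∧ v = latticePt k (m + ind I) := by
  obtain ⟨-, c, hc, r, hr, hsr⟩ := hs
  obtain ⟨m', rfl⟩ := latticePt_surjective hk v
  have : Nonempty (Fin k) := ⟨⟨0, hk⟩⟩
  obtain ⟨i₀, hi₀⟩ := Finite.exists_min fun i => m' i - m i
  refine ⟨({i | m' i - m i ≠ m' i₀ - m i₀} : Finset (Fin k)), fun h => ?_, ?_⟩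
  · have := h ▸ mem_univ i₀
    simp at this
  · have hm' : m' = m + ind {i | m' i - m i ≠ m' i₀ - m i₀} + fun _ => m' i₀ - m i₀ := by
      funext i
      have h1 := sub_le_one_of_minimal hc hr (hsr _ hm) (hsr _ hv) i i₀
      have h2 := hi₀ i
      simp only [Pi.add_apply, ind, mem_filter, mem_univ, true_and]
      split_ifs <;> omega
    conv_lhs => rw [hm', map_add, latticePt_const, add_zero]

/-- Every Delone simplex lies in a chain: seen from one of its vertices, the others correspond to
proper subsets, any two of them nested. -/
theorem exists_subset_latticeSimplex (hk : 0 < k) {s : Finset (permLattice k)}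
    (hs : s ∈ (deloneComplex k).faces) :
    ∃ z σ, (s : Set (permLattice k)) ⊆ latticeSimplex z σ := by
  have hs' := hs
  obtain ⟨⟨u, hu⟩, c, hc, r, hr, hsr⟩ := hs
  obtain ⟨m₀, rfl⟩ := latticePt_surjective hk u
  have key : ∀ v ∈ s, ∃ I : Finset (Fin k), I ≠ univ ∧ v = latticePt k (m₀ + ind I) :=
    fun v hv => exists_eq_latticePt_add_of_mem hs' hu hv hk
  choose! I hI hIv using key
  have nested : ∀ v ∈ s, ∀ w ∈ s, I v ⊆ I w ∨ I w ⊆ I v := by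
    intro v hv w hw
    by_contra! h
    obtain ⟨⟨i, hi, hi'⟩, ⟨j, hj, hj'⟩⟩ := And.intro (not_subset.1 h.1) (not_subset.1 h.2)
    have := sub_le_one_of_minimal hc hr (hIv w hw ▸ hsr w hw) (hIv v hv ▸ hsr v hv) i j
    simp [ind, hi, hi', hj, hj'] at this
  -- Sort by decreasing number of the sets `I v` containing an index: each `I v` is then initial.
  let rank : Fin k → ℤ := fun i => -(#{v ∈ s | i ∈ I v} : ℤ)
  refine ⟨latticePt k m₀, Tuple.sort rank, fun v hv => ?_⟩
  obtain ⟨j, hj⟩ := exists_eq_map_Iio rank (Tuple.sort rank) (Tuple.monotone_sort rank)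
    (hI v hv) (by
    intro i hi j hij
    by_contra hj
    refine absurd hij (not_le.2 (neg_lt_neg (Nat.cast_lt.2 (card_lt_card ?_))))
    refine (ssubset_iff_of_subset fun w hw => ?_).2 ⟨v, by simpa [hi] using hv, by simp [hj]⟩
    simp only [mem_filter] at hw ⊢
    refine ⟨hw.1, ?_⟩
    rcases nested v hv w hw.1 with h | h
    · exact h hi
    · exact (hj (h hw.2)).elim)
  refine ⟨j, ?_⟩
  dsimp only
  rw [← hj, ← map_add, ← hIv v hv]

/-! ### The tonnetz as a quotient of the Delone complex -/

theorem exists_sort_eq_map_Iio {I : Finset (Fin k)} (hI : I ≠ univ) :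
    ∃ (σ : Equiv.Perm (Fin k)) (j : Fin k), I = (Iio j).map σ.toEmbedding := by
  refine ⟨_, exists_eq_map_Iio (fun i => -ind I i) _ (Tuple.monotone_sort _) hI ?_⟩
  intro i hi j hj
  by_contra h
  simp [ind, hi, h] at hj

theorem hasGcdOne_pos {l : Fin k → ℕ} (hred : HasGcdOne l) : 0 < k := by
  rcases Nat.eq_zero_or_pos k with rfl | h
  · simp [HasGcdOne] at hred
  · exact h

section Degree

variable {l : Fin k → ℕ} {f : permLattice k →+ ZMod n}

theorem degree_surjective (hf : ∀ m, f (latticePt k m) = intDegree n l m) (hred : HasGcdOne l) :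
    Function.Surjective f := by
  intro x
  obtain ⟨m, rfl⟩ := intDegree_surjective hred x
  exact ⟨_, hf m⟩

open Classical in
/-- The faces of the tonnetz are the images of the Delone simplices under the degree. -/
theorem mem_tonn_iff (hf : ∀ m, f (latticePt k m) = intDegree n l m) (hred : HasGcdOne l)
    (s : Finset (ZMod n)) :
    s ∈ (tonn n l).faces ↔ ∃ t ∈ (deloneComplex k).faces, t.image f = s := by
  have hk := hasGcdOne_pos hred
  have hval (z : permLattice k) (I : Finset (Fin k)) :
      f (z + latticePt k (ind I)) = f z + ((∑ i ∈ I, l i : ℕ) : ZMod n) := by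
    rw [map_add, hf, intDegree_ind]
  constructor
  · rintro ⟨hs, x, σ, h⟩
    obtain ⟨z, rfl⟩ := degree_surjective hf hred x
    have h' : (s : Set (ZMod n)) ⊆ f '' latticeSimplex z σ := by
      intro y hy
      obtain ⟨j, rfl⟩ := (mem_maxSimplex _ _ _ _).1 (h hy)
      exact ⟨_, ⟨j, rfl⟩, hval _ _⟩
    obtain ⟨t, ht, rfl⟩ := Finset.subset_set_image_iff.1 h'
    exact ⟨t, mem_deloneComplex_of_subset_latticeSimplex hk (Finset.image_nonempty.1 hs) ht, rfl⟩
  · rintro ⟨t, ht, rfl⟩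
    obtain ⟨z, σ, h⟩ := exists_subset_latticeSimplex hk ht
    refine ⟨Finset.image_nonempty.2 ht.1, f z, σ, ?_⟩
    intro y hy
    obtain ⟨w, hw, rfl⟩ := mem_image.1 hy
    obtain ⟨j, rfl⟩ := h hw
    exact (mem_maxSimplex _ _ _ _).2 ⟨j, (hval _ _).symm⟩

/-- The difference of two vertices of a Delone simplex is determined by the difference of their
degrees. Here genericity enters. -/
theorem sub_eq_sub_of_mem_faces (hf : ∀ m, f (latticePt k m) = intDegree n l m)
    (hpos : ∀ i, 0 < l i) (hsum : ∑ i, l i = n) (hgen : IsGeneric l) (hk : 0 < k)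
    {s t : Finset (permLattice k)} (hs : s ∈ (deloneComplex k).faces)
    (ht : t ∈ (deloneComplex k).faces) {u v u' v' : permLattice k} (hu : u ∈ s) (hv : v ∈ s)
    (hu' : u' ∈ t) (hv' : v' ∈ t) (h : f v - f u = f v' - f u') : v - u = v' - u' := by
  obtain ⟨m, rfl⟩ := latticePt_surjective hk u
  obtain ⟨m', rfl⟩ := latticePt_surjective hk u'
  obtain ⟨I, hI, rfl⟩ := exists_eq_latticePt_add_of_mem hs hu hv hk
  obtain ⟨J, hJ, rfl⟩ := exists_eq_latticePt_add_of_mem ht hu' hv' hk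
  simp only [map_add, add_sub_cancel_left, hf, intDegree_ind] at h ⊢
  rw [eq_of_cast_sum_eq hpos hsum hgen hI hJ h]

theorem isRegularQuotient_ker (hf : ∀ m, f (latticePt k m) = intDegree n l m)
    (hpos : ∀ i, 0 < l i) (hsum : ∑ i, l i = n) (hgen : IsGeneric l) (hk : 0 < k) :
    IsRegularQuotient (deloneComplex k) f.ker := by
  classical
  have hmk (u v : permLattice k) :
      (QuotientAddGroup.mk u : permLattice k ⧸ f.ker) = QuotientAddGroup.mk v ↔ f u = f v := by
    rw [QuotientAddGroup.eq, AddMonoidHom.mem_ker, map_add, map_neg, neg_add_eq_zero]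
  refine ⟨fun s hs u hu v hv h => ?_, fun s hs t ht h => ?_⟩
  · rw [hmk] at h
    have := sub_eq_sub_of_mem_faces hf hpos hsum hgen hk hs hs hu hu hu hv (by simp [h])
    rw [sub_self] at this
    exact (sub_eq_zero.1 this.symm).symm
  · have hst : ∀ v ∈ s, ∃ v' ∈ t, f v' = f v := fun v hv => by
      have : (QuotientAddGroup.mk v : permLattice k ⧸ f.ker) ∈ t.image QuotientAddGroup.mk := by
        convert mem_image_of_mem (QuotientAddGroup.mk : _ → permLattice k ⧸ f.ker) hv using 1
        convert h.symm
      obtain ⟨v', hv', e⟩ := mem_image.1 this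
      exact ⟨v', hv', (hmk _ _).1 e⟩
    have hts : ∀ v ∈ t, ∃ v' ∈ s, f v' = f v := fun v hv => by
      have : (QuotientAddGroup.mk v : permLattice k ⧸ f.ker) ∈ s.image QuotientAddGroup.mk := by
        convert mem_image_of_mem (QuotientAddGroup.mk : _ → permLattice k ⧸ f.ker) hv using 1
        convert h
      obtain ⟨v', hv', e⟩ := mem_image.1 this
      exact ⟨v', hv', (hmk _ _).1 e⟩
    -- The translation is fixed by one pair of vertices of equal degree.
    obtain ⟨u, hu⟩ := hs.1
    obtain ⟨u', hu', huu⟩ := hst u hu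
    refine ⟨u' - u, by rw [AddMonoidHom.mem_ker, map_sub, huu, sub_self], ?_⟩
    have key {v v' : permLattice k} (hv : v ∈ s) (hv' : v' ∈ t) (e : f v' = f v) :
        u' - u + v = v' := by
      have := sub_eq_sub_of_mem_faces hf hpos hsum hgen hk hs ht hu hv hu' hv' (by rw [e, huu])
      rw [sub_add_eq_add_sub, add_sub_assoc, this, add_sub_cancel]
    ext w
    refine Iff.trans ?_ (@mem_image _ _ (fun a b => Classical.propDecidable (a = b)) _ _ _).symm
    constructor
    · intro hw
      obtain ⟨v, hv, e⟩ := hts w hw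
      exact ⟨v, hv, key hv hw e.symm⟩
    · rintro ⟨v, hv, rfl⟩
      obtain ⟨v', hv', e⟩ := hst v hv
      rw [key hv hv' e]
      exact hv'

theorem isomorphic_quotientComplex_ker (hf : ∀ m, f (latticePt k m) = intDegree n l m)
    (hred : HasGcdOne l) : Isomorphic (tonn n l) (quotientComplex (deloneComplex k) f.ker) := by
  classical
  let e := QuotientAddGroup.quotientKerEquivOfSurjective f (degree_surjective hf hred)
  refine ⟨e.symm.toEquiv, fun s => ?_⟩
  have he (z : permLattice k) : e.symm (f z) = QuotientAddGroup.mk z := by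
    rw [AddEquiv.symm_apply_eq]
    rfl
  rw [mem_tonn_iff hf hred]
  refine Iff.trans ?_ (Set.mem_image _ _ _).symm
  refine exists_congr fun t => and_congr_right fun ht => ?_
  have hmk (d : DecidableEq (permLattice k ⧸ f.ker)) :
      @image _ _ d (QuotientAddGroup.mk : permLattice k → permLattice k ⧸ f.ker) t
        = (t.image f).map e.symm.toEquiv.toEmbedding := by
    rw [map_eq_image, image_image]
    exact image_congr fun z _ => (he z).symm
  constructor
  · rintro rfl
    exact hmk _
  · intro h
    refine Finset.map_injective e.symm.toEquiv.toEmbedding ?_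
    exact (hmk _).symm.trans h

/-! ### The period lattice is the kernel of the degree -/

/-- Every oriented edge of the tonnetz has a type. -/
theorem exists_edge_type (hf : ∀ m, f (latticePt k m) = intDegree n l m) (hred : HasGcdOne l)
    (e : OrientedEdge n l) : ∃ I : Finset (Fin k), I ≠ univ ∧
      ((∑ i ∈ I, l i : ℕ) : ZMod n) = e.1.2 - e.1.1 := by
  classical
  obtain ⟨⟨u, v⟩, -, he⟩ := e
  obtain ⟨t, ht, het⟩ := (mem_tonn_iff hf hred _).1 he
  have h1 : u ∈ t.image f := by rw [het]; simp
  have h2 : v ∈ t.image f := by rw [het]; simp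
  obtain ⟨u', hu', rfl⟩ := mem_image.1 h1
  obtain ⟨v', hv', rfl⟩ := mem_image.1 h2
  obtain ⟨m, rfl⟩ := latticePt_surjective (hasGcdOne_pos hred) u'
  obtain ⟨I, hI, rfl⟩ := exists_eq_latticePt_add_of_mem ht hu' hv' (hasGcdOne_pos hred)
  exact ⟨I, hI, by simp [hf, intDegree_ind]⟩

theorem omega_eq (hpos : ∀ i, 0 < l i) (hsum : ∑ i, l i = n) (hgen : IsGeneric l)
    (e : OrientedEdge n l) {I : Finset (Fin k)} (hI : I ≠ univ)
    (h : ((∑ i ∈ I, l i : ℕ) : ZMod n) = e.1.2 - e.1.1) : omega n l e = latticePt k (ind I) := by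
  have huniv {J : Finset (Fin k)} (hJ : ((∑ i ∈ J, l i : ℕ) : ZMod n) = e.1.2 - e.1.1) :
      J ≠ univ := by
    rintro rfl
    rw [hsum, ZMod.natCast_self] at hJ
    exact e.2.1 (sub_eq_zero.1 hJ.symm).symm
  have : ({J : Finset (Fin k) | ((∑ i ∈ J, l i : ℕ) : ZMod n) = e.1.2 - e.1.1} :
      Finset (Finset (Fin k))) = {I} := by
    ext J
    simp only [mem_filter, mem_univ, true_and, mem_singleton]
    refine ⟨fun hJ => eq_of_cast_sum_eq hpos hsum hgen (huniv hJ) hI (hJ.trans h.symm), ?_⟩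
    rintro rfl
    exact h
  rw [omega, this, sum_singleton, latticePt_ind]

/-- On an edge from `u` to `v`, the cochain `ω` has degree `v - u`; hence the degree of `ω` on a
chain depends on its boundary only. -/
theorem periodLattice_le_ker (hf : ∀ m, f (latticePt k m) = intDegree n l m)
    (hpos : ∀ i, 0 < l i) (hsum : ∑ i, l i = n) (hgen : IsGeneric l) (hred : HasGcdOne l) :
    periodLattice n l ≤ f.ker := by
  have hω (e : OrientedEdge n l) : f (omega n l e) = e.1.2 - e.1.1 := by
    obtain ⟨I, hI, h⟩ := exists_edge_type hf hred e
    rw [omega_eq hpos hsum hgen e hI h, hf, intDegree_ind, h]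
  have hcomp : f.toIntLinearMap ∘ₗ Finsupp.linearCombination ℤ (omega n l)
      = Finsupp.linearCombination ℤ (id : ZMod n → ZMod n) ∘ₗ
        Finsupp.linearCombination ℤ fun e : OrientedEdge n l =>
          (Finsupp.single e.1.2 1 - Finsupp.single e.1.1 1 : ZMod n →₀ ℤ) := by
    ext e
    simp [hω]
  rintro z ⟨c, hc, rfl⟩
  have := LinearMap.congr_fun hcomp c
  rw [LinearMap.comp_apply, LinearMap.comp_apply, LinearMap.mem_ker.1 hc, map_zero] at this
  exact this

/-- The vectors `m ∈ ℤ^k` such that from every vertex `x` there is a `1`-chain with boundary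
`[x + deg m] - [x]` on which `ω` has the value `∑ m_i a_i`. -/
noncomputable def pathSubgroup (n : ℕ) (l : Fin k → ℕ) : AddSubgroup (Fin k → ℤ) where
  carrier := {m | ∀ x : ZMod n, ∃ c : OrientedEdge n l →₀ ℤ,
    Finsupp.linearCombination ℤ (fun e : OrientedEdge n l =>
      (Finsupp.single e.1.2 1 - Finsupp.single e.1.1 1 : ZMod n →₀ ℤ)) c
        = Finsupp.single (x + intDegree n l m) 1 - Finsupp.single x 1 ∧
    Finsupp.linearCombination ℤ (omega n l) c = latticePt k m}
  zero_mem' x := ⟨0, by simp⟩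
  add_mem' := by
    intro m m' hm hm' x
    obtain ⟨c, hc, hc'⟩ := hm x
    obtain ⟨d, hd, hd'⟩ := hm' (x + intDegree n l m)
    refine ⟨c + d, ?_, by rw [map_add, hc', hd', map_add]⟩
    rw [map_add, hc, hd, map_add, add_assoc]
    abel
  neg_mem' := by
    intro m hm x
    obtain ⟨c, hc, hc'⟩ := hm (x - intDegree n l m)
    refine ⟨-c, ?_, by rw [map_neg, hc', map_neg]⟩
    rw [map_neg, hc, map_neg, sub_add_cancel, neg_sub, sub_eq_add_neg x]

theorem pathSubgroup_eq_top (hpos : ∀ i, 0 < l i) (hsum : ∑ i, l i = n) (hgen : IsGeneric l) :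
    pathSubgroup n l = ⊤ := by
  have hsingle : ∀ i, ind {i} ∈ pathSubgroup n l := by
    intro i x
    have hk := i.pos
    by_cases hi : ({i} : Finset (Fin k)) = univ
    · -- Here `k = 1`: there are no edges, and `a_i = 0`.
      refine ⟨0, ?_, by rw [map_zero, hi, latticePt_ind_univ]⟩
      rw [intDegree_ind, hi, hsum]
      simp
    · have hne : x ≠ x + intDegree n l (ind {i}) := by
        intro h
        rw [left_eq_add, intDegree_ind] at h
        have := eq_of_cast_sum_eq hpos hsum hgen hi (J := ∅)
          (fun h => Finset.notMem_empty i (h ▸ mem_univ i)) (by rw [h]; simp)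
        simp at this
      obtain ⟨σ, j, hj⟩ := exists_sort_eq_map_Iio hi
      have hface : ({x, x + intDegree n l (ind {i})} : Finset (ZMod n)) ∈ (tonn n l).faces := by
        refine ⟨by simp, x, σ, ?_⟩
        intro y hy
        rw [mem_maxSimplex]
        rcases mem_insert.1 hy with rfl | hy
        · refine ⟨⟨0, hk⟩, ?_⟩
          have : Iio (⟨0, hk⟩ : Fin k) = ∅ := by
            ext a; simp [Fin.lt_def]
          simp [this]
        · rw [mem_singleton.1 hy, intDegree_ind]
          exact ⟨j, by rw [hj]⟩
      let e : OrientedEdge n l := ⟨(x, x + intDegree n l (ind {i})), hne, hface⟩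
      refine ⟨Finsupp.single e 1, by simp [e], ?_⟩
      rw [Finsupp.linearCombination_single, one_smul]
      exact omega_eq hpos hsum hgen e hi (by simp [e, intDegree_ind])
  refine eq_top_iff.2 fun m _ => ?_
  have : m = ∑ i, m i • ind {i} := by
    funext j
    simp [ind]
  rw [this]
  exact sum_mem fun i _ => zsmul_mem (hsingle i) _

theorem periodLattice_eq_ker (hf : ∀ m, f (latticePt k m) = intDegree n l m)
    (hpos : ∀ i, 0 < l i) (hsum : ∑ i, l i = n) (hgen : IsGeneric l) (hred : HasGcdOne l) :
    periodLattice n l = f.ker := by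
  refine le_antisymm (periodLattice_le_ker hf hpos hsum hgen hred) fun z hz => ?_
  obtain ⟨m, rfl⟩ := latticePt_surjective (hasGcdOne_pos hred) z
  have hm : m ∈ pathSubgroup n l := by
    rw [pathSubgroup_eq_top hpos hsum hgen]
    trivial
  obtain ⟨c, hc, hc'⟩ := hm 0
  refine ⟨c, ?_, hc'⟩
  rw [AddMonoidHom.mem_ker, hf] at hz
  simp only [cycles, SetLike.mem_coe, LinearMap.mem_ker]
  rw [hc, hz, add_zero, sub_self]

end Degree

/-! ### Barycentric coordinates by integration -/

/-- The set of `s ∈ [0, 1]` with `a ≤ s` has length `1 - a`. -/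
theorem integral_step {a : ℝ} (h0 : 0 ≤ a) (h1 : a ≤ 1) :
    ∫ s in (0 : ℝ)..1, (if a ≤ s then (1 : ℝ) else 0) = 1 - a := by
  have hm : Monotone fun s : ℝ => if a ≤ s then (1 : ℝ) else 0 := by
    intro s s' h
    dsimp only
    split_ifs <;> first | (exfalso; linarith) | norm_num
  rw [← intervalIntegral.integral_add_adjacent_intervals (b := a) hm.intervalIntegrable
    hm.intervalIntegrable]
  rw [intervalIntegral.integral_congr_Ioo_of_le (g := fun _ => (0 : ℝ)) h0
      fun s hs => if_neg (not_le.2 hs.2),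
    intervalIntegral.integral_congr_Ioo_of_le (g := fun _ => (1 : ℝ)) h1
      fun s hs => if_pos hs.1.le]
  simp

theorem intervalIntegrable_step (a : ℝ) :
    IntervalIntegrable (fun s : ℝ => if a ≤ s then (1 : ℝ) else 0) MeasureTheory.volume 0 1 := by
  refine Monotone.intervalIntegrable fun s s' h => ?_
  split_ifs <;> first | (exfalso; linarith) | norm_num

/-- The vertex `deg ⌊t + s(1, …, 1)⌋` of the tonnetz, for `t ∈ ℝ^k` and `s ∈ ℝ`. It is periodic in
`s` with period `1`. -/
noncomputable def sweep (n : ℕ) (l : Fin k → ℕ) (t : Fin k → ℝ) (s : ℝ) : ZMod n :=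
  intDegree n l fun i => ⌊t i + s⌋

/-- The barycentric coordinate at `x` of the point of the realization with parameter `t ∈ ℝ^k`: the
proportion of `s ∈ [0, 1]` for which `⌊t + s(1, …, 1)⌋` has degree `x`. -/
noncomputable def weight (n : ℕ) (l : Fin k → ℕ) (t : Fin k → ℝ) (x : ZMod n) : ℝ :=
  ∫ s in (0 : ℝ)..1, if sweep n l t s = x then 1 else 0

variable {l : Fin k → ℕ}

theorem measurable_comp_sweep (t : Fin k → ℝ) (g : ZMod n → ℝ) :
    Measurable fun s => g (sweep n l t s) := by
  have : Measurable fun (s : ℝ) (i : Fin k) => ⌊t i + s⌋ :=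
    measurable_pi_lambda _ fun i => Int.measurable_floor.comp (measurable_const.add measurable_id)
  exact (Measurable.of_discrete (f := fun m => g (intDegree n l m))).comp this

theorem intervalIntegrable_comp_sweep [NeZero n] (t : Fin k → ℝ) (g : ZMod n → ℝ) :
    IntervalIntegrable (fun s => g (sweep n l t s)) MeasureTheory.volume 0 1 := by
  refine (intervalIntegrable_const (c := ∑ x, |g x|)).mono_fun
    (measurable_comp_sweep t g).aestronglyMeasurable (MeasureTheory.ae_of_all _ fun s => ?_)
  simp only [Real.norm_eq_abs]
  exact (single_le_sum (f := fun x => |g x|) (fun _ _ => abs_nonneg _) (mem_univ _)).trans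
    (le_abs_self _)

theorem integral_comp_sweep [NeZero n] (t : Fin k → ℝ) (g : ZMod n → ℝ) :
    ∫ s in (0 : ℝ)..1, g (sweep n l t s) = ∑ x, weight n l t x * g x := by
  have h (s : ℝ) : g (sweep n l t s) = ∑ x, (if sweep n l t s = x then 1 else 0) * g x := by simp
  simp only [h, weight]
  rw [intervalIntegral.integral_finsetSum fun x _ =>
    (intervalIntegrable_comp_sweep t fun y => if y = x then 1 else 0).mul_const _]
  simp only [intervalIntegral.integral_mul_const]

theorem weight_nonneg (t : Fin k → ℝ) (x : ZMod n) : 0 ≤ weight n l t x :=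
  intervalIntegral.integral_nonneg zero_le_one fun s _ => by split_ifs <;> norm_num

theorem sum_weight [NeZero n] (t : Fin k → ℝ) : ∑ x, weight n l t x = 1 := by
  simpa using (integral_comp_sweep (l := l) t fun _ : ZMod n => (1 : ℝ)).symm

theorem exists_sweep_eq {t : Fin k → ℝ} {x : ZMod n} (h : weight n l t x ≠ 0) :
    ∃ s ∈ Set.Ioo (0 : ℝ) 1, sweep n l t s = x := by
  by_contra! h'
  refine h ?_
  rw [weight, intervalIntegral.integral_congr_Ioo_of_le (g := fun _ => (0 : ℝ)) zero_le_one
    fun s hs => if_neg (h' s hs)]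
  simp

theorem sweep_add_int (t : Fin k → ℝ) (m : Fin k → ℤ) (s : ℝ) :
    sweep n l (fun i => t i + m i) s = sweep n l t s + intDegree n l m := by
  rw [sweep, sweep, ← map_add]
  congr 1
  funext i
  rw [Pi.add_apply, ← Int.floor_add_intCast, add_right_comm]

theorem weight_add_int (t : Fin k → ℝ) (m : Fin k → ℤ) (x : ZMod n) :
    weight n l (fun i => t i + m i) (x + intDegree n l m) = weight n l t x := by
  simp only [weight, sweep_add_int, add_left_inj]

theorem sweep_periodic (hsum : ∑ i, l i = n) (t : Fin k → ℝ) :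
    Function.Periodic (sweep n l t) 1 := by
  intro s
  have h := sweep_add_int (n := n) (l := l) t (fun _ => 1) s
  rw [intDegree_const hsum, add_zero] at h
  rw [← h, sweep, sweep]
  congr 1
  funext i
  push_cast
  ring_nf

theorem weight_add_const (hsum : ∑ i, l i = n) (t : Fin k → ℝ) (c : ℝ) :
    weight n l (fun i => t i + c) = weight n l t := by
  funext x
  have h (s : ℝ) : sweep n l (fun i => t i + c) s = sweep n l t (s + c) := by
    simp only [sweep, add_assoc, add_comm c]
  have hper : Function.Periodic (fun s => if sweep n l t s = x then (1 : ℝ) else 0) 1 := by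
    intro s
    simp only [sweep_periodic hsum t s]
  simp only [weight, h]
  rw [intervalIntegral.integral_comp_add_right (fun s => if sweep n l t s = x then (1 : ℝ) else 0)]
  have := hper.intervalIntegral_add_eq c 0
  rw [zero_add, add_comm c] at *
  exact this

/-- By dominated convergence: for almost every `s`, no `t_i + s` is an integer, and then the floors
are locally constant in `t`. -/
theorem continuous_weight (x : ZMod n) : Continuous fun t : Fin k → ℝ => weight n l t x := by
  refine continuous_iff_continuousAt.2 fun t₀ => ?_
  refine intervalIntegral.continuousAt_of_dominated_interval (bound := fun _ => 1)
    (Filter.Eventually.of_forall fun t =>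
      (measurable_comp_sweep t fun y => if y = x then 1 else 0).aestronglyMeasurable)
    (Filter.Eventually.of_forall fun t => MeasureTheory.ae_of_all _ fun s _ => ?_)
    intervalIntegrable_const ?_
  · split_ifs <;> simp
  · have hc : (⋃ (i : Fin k) (z : ℤ), {(z : ℝ) - t₀ i}).Countable :=
      Set.countable_iUnion fun i => Set.countable_iUnion fun z => Set.countable_singleton _
    filter_upwards [hc.ae_notMem MeasureTheory.volume] with s hs _
    have hev : ∀ᶠ t : Fin k → ℝ in nhds t₀, ∀ i, ⌊t i + s⌋ = ⌊t₀ i + s⌋ := by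
      refine Filter.eventually_all.2 fun i => ?_
      have hcont : Continuous fun t : Fin k → ℝ => t i + s := by fun_prop
      have hne : (⌊t₀ i + s⌋ : ℝ) ≠ t₀ i + s := by
        intro h
        exact hs (Set.mem_iUnion.2 ⟨i, Set.mem_iUnion.2 ⟨⌊t₀ i + s⌋, by
          rw [Set.mem_singleton_iff, h]; ring⟩⟩)
      have hmem : t₀ i + s ∈ Set.Ioo (⌊t₀ i + s⌋ : ℝ) (⌊t₀ i + s⌋ + 1) :=
        ⟨lt_of_le_of_ne (Int.floor_le _) hne, Int.lt_floor_add_one _⟩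
      filter_upwards [hcont.continuousAt.eventually_mem (isOpen_Ioo.mem_nhds hmem)] with t ht
      exact Int.floor_eq_iff.2 ⟨ht.1.le, ht.2⟩
    refine ContinuousAt.congr (f := fun _ => if sweep n l t₀ s = x then (1 : ℝ) else 0)
      continuousAt_const ?_
    filter_upwards [hev] with t ht
    have : sweep n l t s = sweep n l t₀ s := by simp only [sweep, ht]
    rw [this]

/-! ### The fibres of the parametrization -/

theorem floor_add_eq_ind {t : Fin k → ℝ} (h0 : ∀ i, 0 ≤ t i) (h1 : ∀ i, t i ≤ 1) {s : ℝ}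
    (hs : s ∈ Set.Ioo (0 : ℝ) 1) :
    (fun i => ⌊t i + s⌋) = ind {i | 1 ≤ t i + s} := by
  funext i
  have := h0 i
  have := h1 i
  have := hs.1
  have := hs.2
  simp only [ind, mem_filter, mem_univ, true_and]
  rw [Int.floor_eq_iff]
  split_ifs with h <;> push_cast <;> constructor <;> linarith

/-- For `t ∈ [0, 1]^k`, the proportion of `s ∈ [0, 1]` for which all `t_i + s` are at least `1`. -/
noncomputable def fullTime (t : Fin k → ℝ) : ℝ :=
  ∫ s in (0 : ℝ)..1, if ({j | 1 ≤ t j + s} : Finset (Fin k)) = univ then 1 else 0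

open Classical in
/-- Up to a term independent of `i`, the weights determine `t_i = ∫ ⌊t_i + s⌋ ds`: for `s` in
`(0, 1)` the floor vector is the indicator of a subset, which the degree determines unless it is empty
or full. -/
theorem eq_sum_weight_add [NeZero n] (hpos : ∀ i, 0 < l i) (hsum : ∑ i, l i = n)
    (hgen : IsGeneric l) {t : Fin k → ℝ} (h0 : ∀ i, 0 ≤ t i) (h1 : ∀ i, t i ≤ 1) (i : Fin k) :
    t i = ∑ x, weight n l t x * (if ∃ I : Finset (Fin k), I ≠ univ ∧ i ∈ I ∧
        ((∑ j ∈ I, l j : ℕ) : ZMod n) = x then 1 else 0)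
      + fullTime t := by
  unfold fullTime
  rw [← integral_comp_sweep]
  have hstep : ∫ s in (0 : ℝ)..1, (if 1 - t i ≤ s then (1 : ℝ) else 0) = t i := by
    rw [integral_step] <;> linarith [h0 i, h1 i]
  rw [← sub_eq_iff_eq_add']
  nth_rw 1 [← hstep]
  rw [← intervalIntegral.integral_sub (intervalIntegrable_step _)
    (intervalIntegrable_comp_sweep t fun x => if ∃ I : Finset (Fin k), I ≠ univ ∧ i ∈ I ∧
        ((∑ j ∈ I, l j : ℕ) : ZMod n) = x then 1 else 0)]
  refine intervalIntegral.integral_congr_Ioo_of_le zero_le_one fun s hs => ?_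
  have hiff : 1 - t i ≤ s ↔ i ∈ ({j | 1 ≤ t j + s} : Finset (Fin k)) := by
    simp only [mem_filter, mem_univ, true_and, sub_le_iff_le_add']
  rw [sweep, floor_add_eq_ind h0 h1 hs, intDegree_ind]
  simp only [hiff]
  generalize ({j | 1 ≤ t j + s} : Finset (Fin k)) = U
  have hempty : (∅ : Finset (Fin k)) ≠ univ := fun h => notMem_empty i (h ▸ mem_univ i)
  by_cases hU : U = univ
  · subst hU
    have : ¬ ∃ I : Finset (Fin k), I ≠ univ ∧ i ∈ I ∧
        ((∑ j ∈ I, l j : ℕ) : ZMod n) = ((∑ j, l j : ℕ) : ZMod n) := by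
      rintro ⟨I, hI, hi, hI0⟩
      rw [hsum, ZMod.natCast_self] at hI0
      have := eq_of_cast_sum_eq hpos hsum hgen hI hempty (by rw [hI0]; simp)
      simp [this] at hi
    rw [if_neg this, if_pos (mem_univ i), if_pos rfl, sub_zero]
  · have : (∃ I : Finset (Fin k), I ≠ univ ∧ i ∈ I ∧
        ((∑ j ∈ I, l j : ℕ) : ZMod n) = ((∑ j ∈ U, l j : ℕ) : ZMod n)) ↔ i ∈ U := by
      refine ⟨fun ⟨I, hI, hi, h⟩ => ?_, fun h => ⟨U, hU, h, rfl⟩⟩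
      rwa [← eq_of_cast_sum_eq hpos hsum hgen hI hU h]
    simp only [this, hU, sub_self, if_false]

theorem exists_sub_eq_of_weight_eq [NeZero n] (hpos : ∀ i, 0 < l i) (hsum : ∑ i, l i = n)
    (hgen : IsGeneric l) {t t' : Fin k → ℝ} (h0 : ∀ i, 0 ≤ t i) (h1 : ∀ i, t i ≤ 1)
    (h0' : ∀ i, 0 ≤ t' i) (h1' : ∀ i, t' i ≤ 1) (h : weight n l t = weight n l t') :
    ∃ c : ℝ, ∀ i, t i - t' i = c := by
  refine ⟨fullTime t - fullTime t', fun i => ?_⟩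
  have e := eq_sum_weight_add hpos hsum hgen h0 h1 i
  have e' := eq_sum_weight_add hpos hsum hgen h0' h1' i
  rw [h] at e
  refine (congrArg₂ (· - ·) e e').trans ?_
  rw [add_sub_add_left_eq_sub]

/-- The fibres of `t ↦ weight n l t` are the cosets of `ℝ(1, …, 1) + {m ∈ ℤ^k | deg m = 0}`. -/
theorem weight_eq_weight_iff [NeZero n] (hpos : ∀ i, 0 < l i) (hsum : ∑ i, l i = n)
    (hgen : IsGeneric l) (t t' : Fin k → ℝ) : weight n l t = weight n l t' ↔
      ∃ m : Fin k → ℤ, intDegree n l m = 0 ∧ ∃ c : ℝ, ∀ i, t i = t' i + m i + c := by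
  constructor
  · intro h
    obtain ⟨x, hx⟩ : ∃ x, weight n l t x ≠ 0 := by
      by_contra! h0
      simpa [h0] using sum_weight (n := n) (l := l) t
    -- Shift both parameters so that their floor vectors have the common degree `x`; the fractional
    -- parts then have the same weights.
    obtain ⟨s, -, hs⟩ := exists_sweep_eq hx
    obtain ⟨s', -, hs'⟩ := exists_sweep_eq (h ▸ hx)
    have hfr (t : Fin k → ℝ) (s : ℝ) (y : ZMod n) :
        weight n l (fun i => Int.fract (t i + s)) y = weight n l t (y + sweep n l t s) := by
      have h1 := weight_add_int (n := n) (l := l) (fun i => Int.fract (t i + s))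
        (fun i => ⌊t i + s⌋) y
      simp only [Int.fract_add_floor, weight_add_const hsum t s] at h1
      exact h1.symm
    have hw : weight n l (fun i => Int.fract (t i + s))
        = weight n l fun i => Int.fract (t' i + s') := by
      funext y
      rw [hfr, hfr, hs, hs', h]
    refine ⟨(fun i => ⌊t i + s⌋) - fun i => ⌊t' i + s'⌋, ?_, ?_⟩
    · rw [map_sub, sub_eq_zero]
      exact hs.trans hs'.symm
    · obtain ⟨c, hc⟩ := exists_sub_eq_of_weight_eq hpos hsum hgen
        (fun i => Int.fract_nonneg (t i + s)) (fun i => (Int.fract_lt_one (t i + s)).le)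
        (fun i => Int.fract_nonneg (t' i + s')) (fun i => (Int.fract_lt_one (t' i + s')).le) hw
      refine ⟨c + s' - s, fun i => ?_⟩
      have h1 := Int.fract_add_floor (t i + s)
      have h2 := Int.fract_add_floor (t' i + s')
      push_cast [Pi.sub_apply]
      linear_combination hc i - h1 + h2
  · rintro ⟨m, hm, c, h⟩
    obtain rfl : t = fun i => t' i + m i + c := funext h
    rw [weight_add_const hsum (fun i => t' i + m i) c]
    funext x
    have := weight_add_int (n := n) (l := l) t' m x
    rwa [hm, add_zero] at this

/-! ### The image of the parametrization -/

/-- The weights of `t` are carried by the simplex whose permutation sorts the fractional parts of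
`t` in decreasing order. -/
theorem exists_weight_support (hk : 0 < k) (hsum : ∑ i, l i = n) (t : Fin k → ℝ) :
    ∃ (x : ZMod n) (σ : Equiv.Perm (Fin k)), ∀ y ∉ maxSimplex n l x σ, weight n l t y = 0 := by
  refine ⟨intDegree n l fun i => ⌊t i⌋, Tuple.sort fun i => -Int.fract (t i), fun y hy => ?_⟩
  by_contra h
  obtain ⟨s, hs, rfl⟩ := exists_sweep_eq h
  refine hy ((mem_maxSimplex _ _ _ _).2 ?_)
  have hsweep : sweep n l t s = (intDegree n l fun i => ⌊t i⌋)
      + ((∑ i with 1 ≤ Int.fract (t i) + s, l i : ℕ) : ZMod n) := by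
    rw [← intDegree_ind, ← floor_add_eq_ind (fun i => Int.fract_nonneg _)
      (fun i => (Int.fract_lt_one _).le) hs, add_comm]
    rw [← sweep, ← sweep_add_int]
    simp only [Int.fract_add_floor]
  by_cases hU : ({i | 1 ≤ Int.fract (t i) + s} : Finset (Fin k)) = univ
  · refine ⟨⟨0, hk⟩, ?_⟩
    have : Iio (⟨0, hk⟩ : Fin k) = ∅ := by
      ext a; simp [Fin.lt_def]
    rw [hsweep, hU, hsum, this]
    simp
  · obtain ⟨j, hj⟩ := exists_eq_map_Iio _ _
      (Tuple.monotone_sort fun i => -Int.fract (t i)) hU (by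
        intro i hi j hij
        simp only [mem_filter, mem_univ, true_and] at hi ⊢
        linarith)
    exact ⟨j, by rw [hsweep, hj]⟩

theorem injective_vertex (hpos : ∀ i, 0 < l i) (hsum : ∑ i, l i = n) (hgen : IsGeneric l)
    (x : ZMod n) (σ : Equiv.Perm (Fin k)) : Function.Injective fun j : Fin k =>
      x + ((∑ i ∈ (Iio j).map σ.toEmbedding, l i : ℕ) : ZMod n) := by
  intro a b h
  have h' := eq_of_cast_sum_eq hpos hsum hgen (map_Iio_ne_univ σ a) (map_Iio_ne_univ σ b)
    (add_left_cancel h)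
  have := congrArg card h'
  simpa [Fin.ext_iff] using this

/-- Every point of the realization comes from some `t`. With barycentric coordinates `w_0, …,
w_{k-1}` on `Δ(x;σ)`, one takes `t_{σ(j)} = 1 - (w_0 + ⋯ + w_j)` for `0 ≤ j < k`, plus an integer
vector of degree `x`. -/
theorem exists_weight_eq [NeZero n] (hpos : ∀ i, 0 < l i) (hsum : ∑ i, l i = n)
    (hgen : IsGeneric l) (hred : HasGcdOne l) {x : ZMod n} {σ : Equiv.Perm (Fin k)}
    {w : ZMod n → ℝ} (hw0 : ∀ v, 0 ≤ w v) (hw : ∀ v ∉ maxSimplex n l x σ, w v = 0)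
    (hw1 : ∑ v, w v = 1) : ∃ t : Fin k → ℝ, weight n l t = w := by
  have hk := hasGcdOne_pos hred
  obtain ⟨m, hm⟩ := intDegree_surjective hred x
  let p : Fin k → ZMod n := fun j =>
    x + ((∑ i ∈ (Iio j).map σ.toEmbedding, l i : ℕ) : ZMod n)
  have hp : Function.Injective p := injective_vertex hpos hsum hgen x σ
  have hwp (y : ZMod n) (hy : ∀ j, p j ≠ y) : w y = 0 :=
    hw y fun h => by
      obtain ⟨j, hj⟩ := (mem_maxSimplex _ _ _ _).1 h
      exact hy j hj
  have hsum1 : ∑ j, w (p j) = 1 := by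
    rw [← hw1]
    refine (sum_map univ ⟨p, hp⟩ w).symm.trans ?_
    refine sum_subset (subset_univ _) fun y _ hy => hwp y fun j hj => hy ?_
    simp [← hj]
  -- partial sums of the barycentric coordinates
  let V : ℕ → ℝ := fun a => ∑ j : Fin k with j.val < a, w (p j)
  have hV0 : V 0 = 0 := by simp [V]
  have hVk : V k = 1 := by simp [V, hsum1]
  have hVsucc (j : Fin k) : V (j + 1) = V j + w (p j) := by
    have : ({i : Fin k | i.val < j.val + 1} : Finset (Fin k))
        = insert j ({i : Fin k | i.val < j.val} : Finset (Fin k)) := by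
      ext i
      simp only [mem_filter, mem_univ, true_and, mem_insert, Fin.ext_iff]
      omega
    simp only [V]
    rw [this, sum_insert (by simp), add_comm]
  have hVmono : Monotone V := fun a b hab =>
    sum_le_sum_of_subset_of_nonneg (fun i hi => by simp at hi ⊢; omega) fun _ _ _ => hw0 _
  have hV_nonneg (a : ℕ) : 0 ≤ V a := hV0 ▸ hVmono (Nat.zero_le a)
  have hV_le (j : Fin k) : V (j + 1) ≤ 1 := hVk ▸ hVmono j.2
  have hV_le' (j : Fin k) : V j ≤ 1 := hVk ▸ hVmono j.2.le
  let u : Fin k → ℝ := fun i => 1 - V (σ.symm i + 1)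
  have hu0 (i : Fin k) : 0 ≤ u i := sub_nonneg.2 (hV_le _)
  have hu1 (i : Fin k) : u i ≤ 1 := sub_le_self _ (hV_nonneg _)
  -- For `s` in `[V j, V (j + 1))` the sweep is at the `j`-th vertex.
  have hloc : ∀ s ∈ Set.Ioo (0 : ℝ) 1, ∃ j : Fin k, sweep n l (fun i => u i + m i) s = p j ∧
      V j ≤ s ∧ s < V (j + 1) := by
    intro s hs
    have hmem (i : Fin k) : i ∈ ({i | 1 ≤ u i + s} : Finset (Fin k)) ↔ V (σ.symm i + 1) ≤ s := by
      simp only [mem_filter, mem_univ, true_and, u]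
      constructor <;> intro <;> linarith
    obtain ⟨j, hj⟩ := exists_eq_map_Iio (I := {i | 1 ≤ u i + s}) σ.symm σ
      (fun a b hab => by simpa using hab)
      (fun h => by
        have h1 := (hmem (σ ⟨k - 1, by omega⟩)).1 (h ▸ mem_univ _)
        rw [Equiv.symm_apply_apply, Nat.sub_add_cancel hk, hVk] at h1
        linarith [hs.2])
      (fun i hi j hij => by
        rw [hmem] at hi ⊢
        exact (hVmono (Nat.add_le_add_right (Fin.le_def.1 hij) 1)).trans hi)
    have hmem' (a : Fin k) : a < j ↔ V (a + 1) ≤ s := by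
      have := hmem (σ a)
      rw [hj, Equiv.symm_apply_apply] at this
      rw [← this]
      simp
    refine ⟨j, ?_, ?_, ?_⟩
    · rw [sweep_add_int, sweep, floor_add_eq_ind hu0 hu1 hs, hj, intDegree_ind, hm, add_comm]
    · rcases Nat.eq_zero_or_pos j.val with h | h
      · rw [h, hV0]
        exact hs.1.le
      · have := (hmem' ⟨j.val - 1, by omega⟩).1 (by rw [Fin.lt_def]; simp; omega)
        simpa [Nat.sub_add_cancel h] using this
    · have := (hmem' j).not
      simpa using this
  refine ⟨fun i => u i + m i, funext fun y => ?_⟩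
  by_cases hy : ∃ j, p j = y
  · obtain ⟨j, rfl⟩ := hy
    have h : w (p j) = (1 - V j) - (1 - V (j + 1)) := by
      rw [hVsucc]; ring
    rw [h, ← integral_step (hV_nonneg j) (hV_le' j), ← integral_step (hV_nonneg _) (hV_le j),
      ← intervalIntegral.integral_sub (intervalIntegrable_step _) (intervalIntegrable_step _),
      weight]
    refine intervalIntegral.integral_congr_Ioo_of_le zero_le_one fun s hs => ?_
    obtain ⟨i, hi, h1, h2⟩ := hloc s hs
    rw [hi]
    rcases lt_trichotomy i j with hij | rfl | hij
    · have : V (i + 1) ≤ V j := hVmono (Fin.lt_def.1 hij)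
      have : V j ≤ V (j + 1) := hVmono (Nat.le_succ _)
      rw [if_neg (hp.ne hij.ne), if_neg (by linarith), if_neg (by linarith), sub_zero]
    · rw [if_pos rfl, if_pos h1, if_neg (by linarith), sub_zero]
    · have : V (j + 1) ≤ V i := hVmono (Fin.lt_def.1 hij)
      have : V j ≤ V (j + 1) := hVmono (Nat.le_succ _)
      rw [if_neg (hp.ne hij.ne'), if_pos (by linarith), if_pos (by linarith), sub_self]
  · rw [not_exists] at hy
    rw [hwp y hy]
    by_contra h
    obtain ⟨s, hs, hs'⟩ := exists_sweep_eq h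
    obtain ⟨j, hj, -⟩ := hloc s hs
    exact hy j (hj.symm.trans hs')

/-! ### Tori as quotients -/

/-- Two continuous maps from a compact space onto Hausdorff spaces with the same fibres have
homeomorphic images. -/
theorem exists_homeomorph_of_fibers {X Y Z : Type*} [TopologicalSpace X] [CompactSpace X]
    [TopologicalSpace Y] [T2Space Y] [TopologicalSpace Z] [T2Space Z] {f : X → Y} {g : X → Z}
    (hf : Continuous f) (hg : Continuous g) (hfs : Function.Surjective f)
    (hgs : Function.Surjective g) (h : ∀ a b, f a = f b ↔ g a = g b) : Nonempty (Y ≃ₜ Z) := by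
  have hq := Topology.IsQuotientMap.of_surjective_continuous hfs hf
  have : CompactSpace Y := ⟨by rw [← hfs.range_eq]; exact isCompact_range hf⟩
  choose r hr using hfs
  let φ : Y → Z := fun y => g (r y)
  have hφ : φ ∘ f = g := funext fun x => (h _ _).1 (hr (f x))
  have hbij : Function.Bijective φ := by
    refine ⟨fun y y' e => ?_, fun z => ?_⟩
    · rw [← hr y, ← hr y']
      exact (h _ _).2 e
    · obtain ⟨x, rfl⟩ := hgs z
      exact ⟨f x, congrFun hφ x⟩
  have hc : Continuous (Equiv.ofBijective φ hbij) := by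
    change Continuous φ
    rw [hq.continuous_iff, hφ]
    exact hg
  exact ⟨hc.homeoOfEquivCompactToT2⟩

theorem nonempty_homeomorph_torus {d : ℕ} {Y : Type*} [TopologicalSpace Y] [T2Space Y]
    {F : (Fin d → ℝ) → Y} (hF : Continuous F) (hs : Function.Surjective F)
    (h : ∀ x y, F x = F y ↔ ∀ i, ∃ z : ℤ, x i = y i + z) :
    Nonempty (Y ≃ₜ (Fin d → Circle)) := by
  let C := Set.Icc (0 : Fin d → ℝ) 1
  have : CompactSpace C := isCompact_iff_compactSpace.1 isCompact_Icc
  have hfract (x : Fin d → ℝ) : (fun i => Int.fract (x i)) ∈ C :=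
    ⟨fun i => Int.fract_nonneg _, fun i => (Int.fract_lt_one _).le⟩
  have hexp (a b : ℝ) : Circle.exp (2 * Real.pi * a) = Circle.exp (2 * Real.pi * b) ↔
      ∃ z : ℤ, a = b + z := by
    rw [Circle.exp_eq_exp]
    refine exists_congr fun z => ?_
    have : 2 * Real.pi ≠ 0 := by positivity
    rw [← mul_right_inj' this (b := a)]
    ring_nf
  refine exists_homeomorph_of_fibers (X := C) (f := fun x => F x)
    (g := fun x i => Circle.exp (2 * Real.pi * x.1 i)) (hF.comp continuous_subtype_val)
    (continuous_pi fun i => Circle.exp.continuous.comp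
      (continuous_const.mul ((continuous_apply i).comp continuous_subtype_val)))
    (fun y => ?_) (fun c => ?_) fun a b => ?_
  · obtain ⟨x, rfl⟩ := hs y
    exact ⟨⟨_, hfract x⟩, (h _ _).2 fun i => ⟨-⌊x i⌋, by push_cast; rw [Int.fract]; ring⟩⟩
  · choose θ hθ using fun i => Circle.exp_surjective (c i)
    refine ⟨⟨_, hfract fun i => θ i / (2 * Real.pi)⟩, funext fun i => ?_⟩
    rw [← hθ i]
    have h2 : θ i = 2 * Real.pi * (θ i / (2 * Real.pi)) := by field_simp
    conv_rhs => rw [h2]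
    exact (hexp _ _).2 ⟨-⌊θ i / (2 * Real.pi)⌋, by push_cast; rw [Int.fract]; ring⟩
  · rw [h, funext_iff]
    exact forall_congr' fun i => (hexp _ _).symm

instance {V : Type*} (K : PreAbstractSimplicialComplex V) : T2Space (Realization K) :=
  inferInstanceAs (T2Space (Subtype _))

/-! ### Lattices in `H₀` -/

theorem finrank_sumZero (hk : 0 < k) : Module.finrank ℝ (sumZero k) = k - 1 := by
  let φ : EuclideanSpace ℝ (Fin k) →ₗ[ℝ] ℝ :=
    { toFun x := ∑ i, x i
      map_add' x y := by simp [sum_add_distrib]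
      map_smul' c x := by simp [mul_sum] }
  have hker : LinearMap.ker φ = sumZero k := rfl
  have hsurj : Function.Surjective φ := fun r =>
    ⟨EuclideanSpace.single ⟨0, hk⟩ r, by simp [φ]⟩
  have := φ.finrank_range_add_finrank_ker
  rw [LinearMap.range_eq_top.2 hsurj, finrank_top, hker, Module.finrank_self,
    finrank_euclideanSpace_fin] at this
  omega

/-- The inclusion of the lattice into `H₀`. -/
noncomputable def toSumZero (k : ℕ) : permLattice k →ₗ[ℤ] sumZero k :=
  AddMonoidHom.toIntLinearMap
    { toFun z := ⟨z.1, z.2.1⟩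
      map_zero' := rfl
      map_add' _ _ := rfl }

theorem toSumZero_injective : Function.Injective (toSumZero k) := fun _ _ h =>
  Subtype.ext (congrArg (fun v : sumZero k => (v : EuclideanSpace ℝ (Fin k))) h)

/-- A subgroup of the permutohedral lattice, viewed inside the real vector space `H₀`. -/
noncomputable def realLattice (N : AddSubgroup (permLattice k)) : Submodule ℤ (sumZero k) :=
  N.toIntSubmodule.map (toSumZero k)

/-- Passing to `H₀` does not change the group. -/
noncomputable def realLatticeEquiv (N : AddSubgroup (permLattice k)) :
    N ≃ₗ[ℤ] realLattice N :=
  N.toIntSubmodule.equivMapOfInjective (toSumZero k) toSumZero_injective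

instance (N : AddSubgroup (permLattice k)) : DiscreteTopology (realLattice N) := by
  rw [discreteTopology_iff_isOpen_singleton_zero]
  refine Metric.isOpen_singleton_iff.2 ⟨1, one_pos, ?_⟩
  rintro ⟨v, z, hz, rfl⟩ h
  obtain ⟨p, hp, -⟩ := z.2.2
  have hp0 (i : Fin k) : p i = 0 := by
    have h1 : ‖(z : EuclideanSpace ℝ (Fin k)) i‖ < 1 := by
      refine (PiLp.norm_apply_le _ i).trans_lt ?_
      rw [dist_zero_right] at h
      exact h
    rw [hp, Real.norm_eq_abs] at h1
    exact Int.abs_lt_one_iff.1 (by exact_mod_cast h1)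
  have : z = 0 := by
    ext i
    simp [hp, hp0]
  ext1
  simp [this]

/-- The kernel contains `n a_i` for every `i`, and the `a_i` span `H₀`. -/
theorem isZLattice_realLattice_ker (hk : 0 < k) [NeZero n] (f : permLattice k →+ ZMod n) :
    IsZLattice ℝ (realLattice f.ker) where
  span_top := by
    refine eq_top_iff.2 fun v _ => ?_
    have hn : (n : ℝ) ≠ 0 := NeZero.ne _
    have hk' : (k : ℝ) ≠ 0 := by positivity
    have hv : ∑ i, (v : EuclideanSpace ℝ (Fin k)) i = 0 := v.2
    have hmem (i : Fin k) : toSumZero k (n • latticeVec k i) ∈ (realLattice f.ker : Set _) :=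
      ⟨_, by simp [AddMonoidHom.mem_ker], rfl⟩
    have : v = ∑ i, ((v : EuclideanSpace ℝ (Fin k)) i / k / n) •
        toSumZero k (n • latticeVec k i) := by
      ext j
      have happ (i : Fin k) : (toSumZero k (n • latticeVec k i) : EuclideanSpace ℝ (Fin k)) j
          = n * ((if j = i then (k : ℝ) else 0) - 1) := by
        change ((n • latticeVec k i : permLattice k) : EuclideanSpace ℝ (Fin k)) j = _
        rw [AddSubgroup.coe_nsmul, PiLp.smul_apply, latticeVec_apply, nsmul_eq_mul]
      simp only [AddSubmonoidClass.coe_finsetSum, WithLp.ofLp_sum, Finset.sum_apply,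
        Submodule.coe_smul, PiLp.smul_apply, smul_eq_mul, happ]
      have h1 (i : Fin k) : (v : EuclideanSpace ℝ (Fin k)) i / k / n *
          (n * ((if j = i then (k : ℝ) else 0) - 1))
          = (if j = i then (v : EuclideanSpace ℝ (Fin k)) i else 0)
            - (v : EuclideanSpace ℝ (Fin k)) i / k := by
        split_ifs
        · field_simp
        · field_simp
          ring
      simp only [h1, sum_sub_distrib, ← sum_div, hv]
      simp
    rw [this]
    exact Submodule.sum_mem _ fun i _ => Submodule.smul_mem _ _ (Submodule.subset_span (hmem i))

/-! ### The realization of the tonnetz is a torus -/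

/-- The point of the realization of the tonnetz with parameter `t ∈ ℝ^k`. -/
noncomputable def realizationPoint [NeZero n] (hk : 0 < k) (hsum : ∑ i, l i = n)
    (t : Fin k → ℝ) : Realization (tonn n l) :=
  ⟨weight n l t, by
    obtain ⟨x, σ, h⟩ := exists_weight_support hk hsum t
    refine ⟨maxSimplex n l x σ, ⟨?_, x, σ, subset_rfl⟩, weight_nonneg t, h, ?_⟩
    · have : Nonempty (Fin k) := ⟨⟨0, hk⟩⟩
      exact univ_nonempty.image _
    · rw [← sum_weight (n := n) (l := l) t]
      exact sum_subset (subset_univ _) fun y _ hy => h y hy⟩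

theorem triangulates_of_degree [NeZero n] {f : permLattice k →+ ZMod n}
    (hf : ∀ m, f (latticePt k m) = intDegree n l m) (hpos : ∀ i, 0 < l i)
    (hsum : ∑ i, l i = n) (hgen : IsGeneric l) (hred : HasGcdOne l) :
    Triangulates (tonn n l) (Fin (k - 1) → Circle) := by
  have hk := hasGcdOne_pos hred
  have hk' : (k : ℝ) ≠ 0 := by positivity
  have := isZLattice_realLattice_ker hk f
  have hfree := ZLattice.module_free ℝ (realLattice f.ker)
  have hfin := ZLattice.module_finite ℝ (realLattice f.ker)
  let b := (Module.finBasisOfFinrankEq ℤ (realLattice f.ker)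
    ((ZLattice.rank ℝ _).trans (finrank_sumZero hk))).ofZLatticeBasis ℝ (realLattice f.ker)
  have hb : Submodule.span ℤ (Set.range b) = realLattice f.ker :=
    Module.Basis.ofZLatticeBasis_span ..
  let e := b.equivFun.symm
  have hcoord : Continuous fun x : Fin (k - 1) → ℝ => fun i : Fin k =>
      (e x : EuclideanSpace ℝ (Fin k)) i / k := by
    have : Continuous e := LinearMap.continuous_of_finiteDimensional e.toLinearMap
    fun_prop
  refine nonempty_homeomorph_torus
    (F := fun x => realizationPoint hk hsum fun i => (e x : EuclideanSpace ℝ (Fin k)) i / k)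
    (Continuous.subtype_mk (continuous_pi fun x => (continuous_weight x).comp hcoord) _)
    ?_ fun x y => ?_
  · rintro ⟨w, s, ⟨-, x, σ, hsub⟩, hw0, hw, hw1⟩
    obtain ⟨t, ht⟩ := exists_weight_eq hpos hsum hgen hred (x := x) (σ := σ) hw0
      (fun v hv => hw v fun h => hv (hsub h))
      (by rw [← hw1]; exact (sum_subset (subset_univ s) fun v _ hv => hw v hv).symm)
    let v : sumZero k := ⟨WithLp.toLp 2 fun i => k * t i - ∑ j, t j, by
      change ∑ i, (k * t i - ∑ j, t j) = 0
      simp [← mul_sum]⟩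
    refine ⟨e.symm v, Subtype.ext ?_⟩
    change weight n l (fun i => (e (e.symm v) : EuclideanSpace ℝ (Fin k)) i / k) = w
    rw [e.apply_symm_apply, ← ht, ← weight_add_const hsum t (-(∑ j, t j) / k)]
    congr 1
    funext i
    change (k * t i - ∑ j, t j) / k = _
    field_simp
    ring
  · have h1 : (∀ i, ∃ z : ℤ, x i = y i + z) ↔ e x - e y ∈ realLattice f.ker := by
      rw [← hb, Module.Basis.mem_span_iff_repr_mem]
      refine forall_congr' fun i => ?_
      have : b.repr (e x - e y) i = x i - y i := by
        rw [← map_sub, ← b.equivFun_apply]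
        exact congrFun (b.equivFun.apply_symm_apply (x - y)) i
      rw [this]
      refine exists_congr fun z => ?_
      rw [algebraMap_int_eq, eq_intCast, eq_sub_iff_add_eq, add_comm, eq_comm]
    rw [h1]
    refine Iff.trans Subtype.ext_iff ?_
    change weight n l _ = weight n l _ ↔ _
    rw [weight_eq_weight_iff hpos hsum hgen]
    constructor
    · rintro ⟨m, hm, c, h⟩
      refine ⟨latticePt k m, by simpa [AddMonoidHom.mem_ker, hf] using hm, ?_⟩
      have hx : ∑ i, (e x : EuclideanSpace ℝ (Fin k)) i = 0 := (e x).2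
      have hy : ∑ i, (e y : EuclideanSpace ℝ (Fin k)) i = 0 := (e y).2
      have h' (i : Fin k) : (e x : EuclideanSpace ℝ (Fin k)) i
          = (e y : EuclideanSpace ℝ (Fin k)) i + k * m i + k * c := by
        have := h i
        field_simp at this
        linarith
      have hc : ∑ i, (m i : ℝ) = -(k * c) := by
        simp only [h', sum_add_distrib, hy, ← mul_sum, sum_const, card_univ, Fintype.card_fin,
          nsmul_eq_mul, ← mul_add, zero_add] at hx
        linarith [(mul_eq_zero.1 hx).resolve_left hk']
      ext i
      change (latticePt k m : EuclideanSpace ℝ (Fin k)) i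
        = (e x : EuclideanSpace ℝ (Fin k)) i - (e y : EuclideanSpace ℝ (Fin k)) i
      rw [latticePt_apply, h', hc]
      ring
    · rintro ⟨z, hz, hze⟩
      obtain ⟨m, rfl⟩ := latticePt_surjective hk z
      refine ⟨m, (hf m).symm.trans hz, -(∑ i, (m i : ℝ)) / k, fun i => ?_⟩
      have : (latticePt k m : EuclideanSpace ℝ (Fin k)) i
          = (e x : EuclideanSpace ℝ (Fin k)) i - (e y : EuclideanSpace ℝ (Fin k)) i :=
        congrArg (fun v : sumZero k => (v : EuclideanSpace ℝ (Fin k)) i) hze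
      rw [latticePt_apply] at this
      field_simp
      linarith

end Tonnetz

theorem theorem1 (n k : ℕ) (l : Fin k → ℕ) (hpos : ∀ i, 0 < l i) (hsum : ∑ i, l i = n)
    (hgen : Tonnetz.IsGeneric l) (hred : Tonnetz.HasGcdOne l) :
    -- the tonnetz triangulates the torus
    Tonnetz.Triangulates (Tonnetz.tonn n l) (Fin (k - 1) → Circle) ∧
    -- the period lattice is free abelian of rank `k - 1`
    (Module.Free ℤ (Tonnetz.periodLattice n l) ∧
      Module.Finite ℤ (Tonnetz.periodLattice n l) ∧
      Module.finrank ℤ (Tonnetz.periodLattice n l) = k - 1) ∧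
    -- the tonnetz is the quotient of the Delone triangulation by the period lattice
    Tonnetz.IsRegularQuotient (Tonnetz.deloneComplex k) (Tonnetz.periodLattice n l) ∧
    Tonnetz.Isomorphic (Tonnetz.tonn n l)
      (Tonnetz.quotientComplex (Tonnetz.deloneComplex k) (Tonnetz.periodLattice n l)) := by
  have hk := Tonnetz.hasGcdOne_pos hred
  have : NeZero n := ⟨by
    rw [← hsum]
    exact (Finset.sum_pos (fun i _ => hpos i) ⟨⟨0, hk⟩, Finset.mem_univ _⟩).ne'⟩
  obtain ⟨f, hf⟩ := Tonnetz.exists_degree hk hsum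
  rw [Tonnetz.periodLattice_eq_ker hf hpos hsum hgen hred]
  have := Tonnetz.isZLattice_realLattice_ker hk f
  have hfree := ZLattice.module_free ℝ (Tonnetz.realLattice f.ker)
  have hfin := ZLattice.module_finite ℝ (Tonnetz.realLattice f.ker)
  let e := Tonnetz.realLatticeEquiv f.ker
  exact ⟨Tonnetz.triangulates_of_degree hf hpos hsum hgen hred,
    ⟨Module.Free.of_equiv e.symm, Module.Finite.equiv e.symm,
      e.finrank_eq.trans ((ZLattice.rank ℝ _).trans (Tonnetz.finrank_sumZero hk))⟩,
    Tonnetz.isRegularQuotient_ker hf hpos hsum hgen hk,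
    Tonnetz.isomorphic_quotientComplex_ker hf hred⟩
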